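/- Let $q\in\mathbb C$ with $0<|q|<1$. For $x\in\mathbb C$ put $(x;q)_\infty=\prod_{i\ge 0}(1-xq^i)$ and, for $n\in\mathbb Z$, $(x;q)_n=\prod_{i=0}^{n-1}(1-xq^i)$ if $n\ge 0$ and $(x;q)_{n}=\prod_{i=1}^{-n}(1-xq^{-i})^{-1}$ if $n<0$; write $(x_1,\dots,x_r;q)_\infty=(x_1;q)_\infty\cdots(x_r;q)_\infty$. Let $a,b,c$ be nonzero complex numbers in general position, in the sense that none of $a,\ b,\ c,\ a/b,\ a/c,\ bc/a$ is an integer power of $q$, and $b/c\ne q^m$ for every nonzero integer $m$. (These are exactly the conditions under which every expression below is defined.) For $n,k\in\mathbb Z$ let $$A_{n,k}=\frac{(aq/b,\,bq/a,\,aq/c,\,cq/a,\,bq,\,q/b,\,cq,\,q/c;\,q)_\infty}{(q,\,q,\,aq,\,q/a,\,aq/(bc),\,bcq/a,\,cq/b,\,bq/c;\,q)_\infty}\cdot\frac{1-bcq^{2n}/a}{1-bc/a}\cdot\frac{(b;q)_{n+k}\,(a/c;q)_{k-n}}{(cq;q)_{n+k}\,(aq/b;q)_{k-n}},$$ $$B_{n,k}=\frac{1-aq^{2n}}{1-a}\cdot\frac{(c;q)_{n+k}\,(a/b;q)_{n-k}}{(bq;q)_{n+k}\,(aq/c;q)_{n-k}}\,q^{n-k}.$$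 Then the bilateral infinite matrices $A=(A_{n,k})_{n,k\in\mathbb Z}$ and $B=(B_{n,k})_{n,k\in\mathbb Z}$ are inverses of each other: for all $n,l\in\mathbb Z$, $$\sum_{k=-\infty}^{\infty}A_{n,k}B_{k,l}=\delta_{n,l}\qquad\text{and}\qquad \sum_{k=-\infty}^{\infty}B_{n,k}A_{k,l}=\delta_{n,l},$$ where all these series converge absolutely. -/

import Mathlib

noncomputable section

/-- The `q`-shifted factorial `(x; q)_n = ∏_{i=0}^{n-1} (1 - x q^i)` for an integer index `n`.
For `n < 0` the product convention `∏_{i=0}^{n-1} t_i = (t_n t_{n+1} ⋯ t_{-1})⁻¹` is used, that is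
`(x; q)_{-m} = (∏_{i=1}^{m} (1 - x q^{-i}))⁻¹`. -/
def qPoch (x q : ℂ) : ℤ → ℂ
  | Int.ofNat n => ∏ i ∈ Finset.range n, (1 - x * q ^ i)
  | Int.negSucc m => (∏ i ∈ Finset.range (m + 1), (1 - x * q ^ (-((i : ℤ) + 1))))⁻¹

/-- The infinite `q`-shifted factorial `(x; q)_∞ = ∏_{i ≥ 0} (1 - x q^i)`
(the product converges absolutely for `‖q‖ < 1`). -/
def qPochInf (x q : ℂ) : ℂ := ∏' i : ℕ, (1 - x * q ^ i)

/-- Two bilateral infinite matrices are inverses of each other: all the bilateral series that are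
the entries of the products `A B` and `B A` converge unconditionally (over `ℂ`: absolutely), and
both products are the identity matrix. -/
def AreInverseBilateral (A B : Matrix ℤ ℤ ℂ) : Prop :=
  (∀ n l : ℤ, HasSum (fun k : ℤ => A n k * B k l) ((1 : Matrix ℤ ℤ ℂ) n l)) ∧
  (∀ n l : ℤ, HasSum (fun k : ℤ => B n k * A k l) ((1 : Matrix ℤ ℤ ℂ) n l))

/-- The prefactor
`(aq/b, bq/a, aq/c, cq/a, bq, q/b, cq, q/c; q)_∞ /
  (q, q, aq, q/a, aq/(bc), bcq/a, cq/b, bq/c; q)_∞`. -/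
def schlosserPrefactor (q a b c : ℂ) : ℂ :=
  (qPochInf (a * q / b) q * qPochInf (b * q / a) q * qPochInf (a * q / c) q *
      qPochInf (c * q / a) q * qPochInf (b * q) q * qPochInf (q / b) q *
      qPochInf (c * q) q * qPochInf (q / c) q) /
    (qPochInf q q * qPochInf q q * qPochInf (a * q) q * qPochInf (q / a) q *
      qPochInf (a * q / (b * c)) q * qPochInf (b * c * q / a) q *
      qPochInf (c * q / b) q * qPochInf (b * q / c) q)

/-- The matrix `A = (A_{n,k})`. -/
def schlosserA (q a b c : ℂ) : Matrix ℤ ℤ ℂ := fun n k =>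
  schlosserPrefactor q a b c *
    ((1 - b * c * q ^ (2 * n) / a) / (1 - b * c / a)) *
    ((qPoch b q (n + k) * qPoch (a / c) q (k - n)) /
      (qPoch (c * q) q (n + k) * qPoch (a * q / b) q (k - n)))

/-- The matrix `B = (B_{n,k})`. -/
def schlosserB (q a b c : ℂ) : Matrix ℤ ℤ ℂ := fun n k =>
  ((1 - a * q ^ (2 * n)) / (1 - a)) *
    ((qPoch c q (n + k) * qPoch (a / b) q (n - k)) /
      (qPoch (b * q) q (n + k) * qPoch (a * q / c) q (n - k))) *
    q ^ (n - k)

end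

/-!
Each entry of `A B` is a constant times a bilateral series `∑ₖ q⁻ᵏ (1 - a q²ᵏ) H(wₖ)`, where `H` is a
rational function of the *nodes* `wₖ = q⁻ᵏ + a qᵏ`: this is the case of argument `q` of the very
well-poised `₆ψ₆` series. With `J(y) = y + a / y` (`joukowsky`) the nodes are `wₖ = J(q⁻ᵏ)`, and
`wₖ - J(y) = q⁻ᵏ (1 - y qᵏ) (1 - a qᵏ / y)`, so that quotients of shifted factorials with shifts
differing by a fixed integer turn into products of differences `wₖ - J(b qⁱ)` and `wₖ - J(c qⁱ)`.

The series are summed by Lagrange interpolation (`hasSum_of_interpolation`). Let `ξ` be a pole of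
`H`, interpolate the polynomial `(w - ξ) H(w) ∏ⱼ (w - J(c qʲ))`, `-N ≤ j ≤ N`, at the nodes `wₖ` with
`-N ≤ k ≤ N`, and evaluate at `ξ`. This yields the sum of the truncated series whose terms carry the
weights `∏ⱼ (wₖ - J(c qʲ)) / ∏_{i ≠ k} (wₖ - wᵢ)` in place of `q⁻ᵏ (1 - a q²ᵏ)`. The quotients of
these two factors (`windowWeight_eq`) are bounded in `N` and `k` and have as `N → ∞` a nonzero limit
independent of `k`, so dominated convergence gives the sum of the series.

* For `l < n` one takes `ξ = J(c qˡ)`; the polynomial vanishes there, and the sum is `0`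
  (`hasSum_offDiagonal`); the case `n < l` follows by the symmetry `(b, n) ↔ (c, l)` of the terms.
* For `l = n` one has `H(w) = 1 / ((w - J(b qⁿ)) (w - J(c qⁿ)))`, and the sum is a quotient of theta
  functions (`hasSum_diagonal`), which the prefactor of `A` cancels; the dependence on `n` comes from
  the quasi-periodicity of the theta function (`thetaQuotient_mul_zpow`).

The product `B A` reduces to `A B`: the substitution `(a, b, c) ↦ (b c / a, c, b)` exchanges the two
matrices up to conjugation by a diagonal matrix (`schlosserA_dual`, `schlosserB_dual`).
-/

open Filter Topology

/-! ### Finite and infinite `q`-shifted factorials -/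

/-- The finite `q`-shifted factorial `(y; q)_N` for a natural index `N`. -/
def qPochNat (y q : ℂ) (N : ℕ) : ℂ := ∏ i ∈ Finset.range N, (1 - y * q ^ i)

/-- The modified theta function `(y; q)_∞ (q / y; q)_∞`. -/
noncomputable def qTheta (y q : ℂ) : ℂ := qPochInf y q * qPochInf (q / y) q

lemma one_sub_mul_zpow_ne_zero {q y : ℂ} (hy : ∀ m : ℤ, y ≠ q ^ m) (m : ℤ) :
    1 - y * q ^ m ≠ 0 := by
  intro h
  apply hy (-m)
  rw [zpow_neg]
  exact eq_inv_of_mul_eq_one_left (by linear_combination -h)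

lemma one_sub_mul_pow_ne_zero {q y : ℂ} (hy : ∀ m : ℤ, y ≠ q ^ m) (i : ℕ) :
    1 - y * q ^ i ≠ 0 := by
  simpa using one_sub_mul_zpow_ne_zero hy i

lemma one_sub_q_mul_pow_ne_zero {q : ℂ} (hq1 : ‖q‖ < 1) (i : ℕ) : 1 - q * q ^ i ≠ 0 := by
  intro h
  have h1 : q ^ (i + 1) = 1 := by rw [pow_succ]; linear_combination -h
  have h2 : ‖q‖ ^ (i + 1) < 1 := pow_lt_one₀ (norm_nonneg _) hq1 (by omega)
  rw [← norm_pow, h1, norm_one] at h2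
  exact lt_irrefl _ h2

/-- Being off the lattice `q ^ ℤ` is invariant under multiplication by elements of the lattice. -/
lemma mul_zpow_ne_zpow {q y : ℂ} (hq0 : q ≠ 0) (hy : ∀ m : ℤ, y ≠ q ^ m) (n : ℤ) (m : ℤ) :
    y * q ^ n ≠ q ^ m := by
  intro h
  apply hy (m - n)
  rw [zpow_sub₀ hq0, ← h]
  field_simp [zpow_ne_zero n hq0]

lemma inv_ne_zpow {q y : ℂ} (hy : ∀ m : ℤ, y ≠ q ^ m) (m : ℤ) : y⁻¹ ≠ q ^ m := by
  intro h
  apply hy (-m)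
  rw [zpow_neg, ← h, inv_inv]

lemma q_div_ne_zpow {q y : ℂ} (hq0 : q ≠ 0) (hy : ∀ m : ℤ, y ≠ q ^ m) (m : ℤ) : q / y ≠ q ^ m := by
  have := mul_zpow_ne_zpow hq0 (inv_ne_zpow hy) 1 m
  rwa [zpow_one, mul_comm, ← div_eq_mul_inv] at this

lemma summable_norm_mul_pow {q : ℂ} (hq1 : ‖q‖ < 1) (y : ℂ) :
    Summable fun i : ℕ => ‖-(y * q ^ i)‖ := by
  simp only [norm_neg, norm_mul, norm_pow]
  exact (summable_geometric_of_lt_one (norm_nonneg q) hq1).mul_left _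

lemma multipliable_qPochInf {q : ℂ} (hq1 : ‖q‖ < 1) (y : ℂ) :
    Multipliable fun i : ℕ => 1 - y * q ^ i := by
  simpa [sub_eq_add_neg] using multipliable_one_add_of_summable (summable_norm_mul_pow hq1 y)

lemma tendsto_qPochNat {q : ℂ} (hq1 : ‖q‖ < 1) (y : ℂ) :
    Tendsto (qPochNat y q) atTop (𝓝 (qPochInf y q)) :=
  (multipliable_qPochInf hq1 y).tendsto_prod_tprod_nat

lemma qPochInf_ne_zero {q y : ℂ} (hq1 : ‖q‖ < 1) (hy : ∀ i : ℕ, 1 - y * q ^ i ≠ 0) :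
    qPochInf y q ≠ 0 := by
  have := tprod_one_add_ne_zero_of_summable (f := fun i : ℕ => -(y * q ^ i))
    (fun i => by simpa [sub_eq_add_neg] using hy i) (summable_norm_mul_pow hq1 y)
  simpa [qPochInf, sub_eq_add_neg] using this

lemma qPochNat_ne_zero {q y : ℂ} (hy : ∀ i : ℕ, 1 - y * q ^ i ≠ 0) (N : ℕ) :
    qPochNat y q N ≠ 0 :=
  Finset.prod_ne_zero_iff.mpr fun i _ => hy i

lemma qPochInf_eq_mul {q : ℂ} (hq1 : ‖q‖ < 1) (y : ℂ) :
    qPochInf y q = (1 - y) * qPochInf (y * q) q := by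
  have h1 : Multipliable fun i : ℕ => 1 - y * q ^ (i + 1) := by
    simpa [pow_succ', mul_assoc] using multipliable_qPochInf hq1 (y * q)
  have h := tprod_eq_zero_mul' (f := fun i : ℕ => 1 - y * q ^ i) h1
  simpa [qPochInf, pow_succ', mul_assoc] using h

lemma exists_norm_qPochNat_le {q : ℂ} (hq1 : ‖q‖ < 1) (y : ℂ) :
    ∃ K, ∀ N, ‖qPochNat y q N‖ ≤ K := by
  obtain ⟨K, hK⟩ := (Metric.isBounded_range_of_tendsto _ (tendsto_qPochNat hq1 y)).exists_norm_le
  exact ⟨K, fun N => hK _ ⟨N, rfl⟩⟩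

lemma exists_norm_inv_qPochNat_le {q y : ℂ} (hq1 : ‖q‖ < 1) (hy : ∀ i : ℕ, 1 - y * q ^ i ≠ 0) :
    ∃ K, ∀ N, ‖(qPochNat y q N)⁻¹‖ ≤ K := by
  obtain ⟨K, hK⟩ := (Metric.isBounded_range_of_tendsto _
    ((tendsto_qPochNat hq1 y).inv₀ (qPochInf_ne_zero hq1 hy))).exists_norm_le
  exact ⟨K, fun N => hK _ ⟨N, rfl⟩⟩

lemma qTheta_mul_q {q y : ℂ} (hq0 : q ≠ 0) (hq1 : ‖q‖ < 1) (hy : y ≠ 0) :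
    qTheta (y * q) q = -(qTheta y q / y) := by
  unfold qTheta
  have h1 := qPochInf_eq_mul hq1 y
  have h2 := qPochInf_eq_mul hq1 (q / (y * q))
  have h3 : q / (y * q) * q = q / y := by field_simp
  have h4 : q / (y * q) = 1 / y := by field_simp
  rw [h3] at h2
  rw [h1, h2, h4]
  field_simp
  ring

/-! ### Products over symmetric windows of integers -/

lemma prod_Ico_neg_eq (f : ℤ → ℂ) (L M : ℕ) :
    ∏ j ∈ Finset.Ico (-(L : ℤ)) M, f j =
      (∏ i ∈ Finset.range M, f i) * ∏ i ∈ Finset.range L, f (-((i : ℤ) + 1)) := by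
  induction L with
  | zero =>
    simp only [Finset.range_zero, Finset.prod_empty, mul_one]
    induction M with
    | zero => simp
    | succ M ih =>
      have : Finset.Ico (-((0 : ℕ) : ℤ)) ((M + 1 : ℕ) : ℤ) =
          insert (M : ℤ) (Finset.Ico (-((0 : ℕ) : ℤ)) (M : ℤ)) := by
        ext j; simp only [Finset.mem_insert, Finset.mem_Ico]; omega
      rw [this, Finset.prod_insert (by simp), ih, Finset.prod_range_succ, mul_comm]
  | succ L ih =>
    have : Finset.Ico (-((L + 1 : ℕ) : ℤ)) (M : ℤ) =
        insert (-((L : ℤ) + 1)) (Finset.Ico (-(L : ℤ)) (M : ℤ)) := by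
      ext j; simp only [Finset.mem_insert, Finset.mem_Ico]; omega
    rw [this, Finset.prod_insert (by simp), ih, Finset.prod_range_succ]
    ring

lemma prod_Ico_neg_erase_eq (f : ℤ → ℂ) (L M : ℕ) :
    ∏ j ∈ (Finset.Ico (-(L : ℤ)) (M + 1)).erase 0, f j =
      (∏ i ∈ Finset.range M, f (i + 1)) * ∏ i ∈ Finset.range L, f (-((i : ℤ) + 1)) := by
  have h := prod_Ico_neg_eq (fun j => if j = 0 then 1 else f j) L (M + 1)
  rw [Finset.prod_range_succ', ← Finset.prod_erase (a := (0 : ℤ)) _ (by simp)] at h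
  push_cast at h
  simp only [mul_one] at h
  rw [Finset.prod_congr rfl (g := f) fun j hj => if_neg (Finset.ne_of_mem_erase hj)] at h
  rw [h]
  exact congrArg₂ _ (Finset.prod_congr rfl fun i _ => if_neg (by omega))
    (Finset.prod_congr rfl fun i _ => if_neg (by omega))

/-- Turning around the factors with negative index: `1 - y q⁻ʲ = (-y q⁻ʲ) (1 - q ʲ / y)`. -/
lemma prod_one_sub_mul_zpow_neg {q y : ℂ} (hq0 : q ≠ 0) (hy : y ≠ 0) (L : ℕ) :
    ∏ i ∈ Finset.range L, (1 - y * q ^ (-((i : ℤ) + 1))) =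
      (-y) ^ L * (∏ i ∈ Finset.range L, q ^ (-((i : ℤ) + 1))) * qPochNat (q / y) q L := by
  rw [qPochNat, ← Finset.card_range L, ← Finset.prod_const, Finset.card_range,
    ← Finset.prod_mul_distrib, ← Finset.prod_mul_distrib]
  refine Finset.prod_congr rfl fun i _ => ?_
  rw [zpow_neg, zpow_add₀ hq0, zpow_natCast, zpow_one]
  have := pow_ne_zero i hq0
  field_simp
  ring

lemma prod_window {q y : ℂ} (hq0 : q ≠ 0) (hy : y ≠ 0) (L M : ℕ) :
    ∏ j ∈ Finset.Ico (-(L : ℤ)) M, (1 - y * q ^ j) =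
      (-y) ^ L * (∏ i ∈ Finset.range L, q ^ (-((i : ℤ) + 1))) *
        (qPochNat y q M * qPochNat (q / y) q L) := by
  rw [prod_Ico_neg_eq, prod_one_sub_mul_zpow_neg hq0 hy]
  simp only [zpow_natCast, qPochNat]
  ring

lemma prod_window_erase {q y : ℂ} (hq0 : q ≠ 0) (hy : y ≠ 0) (L M : ℕ) :
    ∏ j ∈ (Finset.Ico (-(L : ℤ)) (M + 1)).erase 0, (1 - y * q ^ j) =
      (-y) ^ L * (∏ i ∈ Finset.range L, q ^ (-((i : ℤ) + 1))) *
        (qPochNat (y * q) q M * qPochNat (q / y) q L) := by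
  rw [prod_Ico_neg_erase_eq, prod_one_sub_mul_zpow_neg hq0 hy]
  have : ∏ i ∈ Finset.range M, (1 - y * q ^ ((i : ℤ) + 1)) = qPochNat (y * q) q M :=
    Finset.prod_congr rfl fun i _ => by rw [zpow_add₀ hq0, zpow_natCast, zpow_one]; ring
  rw [this]
  ring

/-! ### The nodes `q⁻ᵏ + a qᵏ` -/

/-- The map `y ↦ y + a / y`, invariant under `y ↦ a / y`. -/
noncomputable def joukowsky (a y : ℂ) : ℂ := y + a / y

lemma joukowsky_zpow_sub {q a y : ℂ} (hq0 : q ≠ 0) (hy : y ≠ 0) (k : ℤ) :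
    joukowsky a (q ^ (-k)) - joukowsky a y =
      q ^ (-k) * ((1 - y * q ^ k) * (1 - a / y * q ^ k)) := by
  unfold joukowsky
  rw [zpow_neg]
  have := zpow_ne_zero k hq0
  field_simp
  ring

lemma joukowsky_zpow_sub_ne_zero {q a y : ℂ} (hq0 : q ≠ 0) (hy0 : y ≠ 0)
    (hy : ∀ m : ℤ, y ≠ q ^ m) (hay : ∀ m : ℤ, a / y ≠ q ^ m) (k : ℤ) :
    joukowsky a (q ^ (-k)) - joukowsky a y ≠ 0 := by
  rw [joukowsky_zpow_sub hq0 hy0]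
  exact mul_ne_zero (zpow_ne_zero _ hq0)
    (mul_ne_zero (one_sub_mul_zpow_ne_zero hy k) (one_sub_mul_zpow_ne_zero hay k))

lemma joukowsky_zpow_sub_shift {q a y : ℂ} (hq0 : q ≠ 0) (hy : y ≠ 0) (k j : ℤ) :
    joukowsky a (q ^ (-k)) - joukowsky a (y * q ^ j) =
      q ^ (-k) * ((1 - y * q ^ (j + k)) * (1 - a / y * q ^ (k - j))) := by
  rw [joukowsky_zpow_sub hq0 (mul_ne_zero hy (zpow_ne_zero j hq0)), zpow_sub₀ hq0, zpow_add₀ hq0]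
  have := zpow_ne_zero j hq0
  field_simp

lemma joukowsky_zpow_sub_zpow {q a : ℂ} (hq0 : q ≠ 0) (k i : ℤ) :
    joukowsky a (q ^ (-k)) - joukowsky a (q ^ (-i)) =
      q ^ (-k) * ((1 - 1 * q ^ (k - i)) * (1 - a * q ^ (k + i))) := by
  have h := joukowsky_zpow_sub_shift (a := a) hq0 one_ne_zero k (-i)
  rwa [one_mul, div_one, sub_neg_eq_add, neg_add_eq_sub] at h

lemma zpow_ne_one_of_norm_lt_one {q : ℂ} (hq1 : ‖q‖ < 1) {m : ℤ} (hm : m ≠ 0) :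
    q ^ m ≠ 1 := by
  intro h
  have h1 : ‖q‖ ^ m = 1 := by rw [← norm_zpow, h, norm_one]
  rw [zpow_eq_one_iff_right₀ (norm_nonneg q) hq1.ne] at h1
  exact hm h1

lemma joukowsky_zpow_injective {q a : ℂ} (hq0 : q ≠ 0) (hq1 : ‖q‖ < 1)
    (ha : ∀ m : ℤ, a ≠ q ^ m) : Function.Injective fun k : ℤ => joukowsky a (q ^ (-k)) := by
  intro k i h
  by_contra hki
  have h' := sub_eq_zero.mpr h
  simp only at h'
  rw [joukowsky_zpow_sub_zpow hq0, one_mul] at h'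
  refine mul_ne_zero (zpow_ne_zero _ hq0) (mul_ne_zero (sub_ne_zero.mpr fun h => ?_)
    (one_sub_mul_zpow_ne_zero ha _)) h'
  exact zpow_ne_one_of_norm_lt_one hq1 (sub_ne_zero.mpr hki) h.symm

/-! ### Growth bounds and summability -/

lemma exists_norm_inv_one_sub_le {q y : ℂ} (hq0 : q ≠ 0) (hq1 : ‖q‖ < 1) (hy0 : y ≠ 0) :
    ∃ K, 0 ≤ K ∧ ∀ n : ℕ, ‖(1 - y * q ^ (n : ℤ))⁻¹‖ ≤ K ∧
      ‖(1 - y * q ^ (-(n : ℤ)))⁻¹‖ ≤ K * ‖q‖ ^ n := by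
  have hq := tendsto_pow_atTop_nhds_zero_of_norm_lt_one hq1
  have h1 : Tendsto (fun n : ℕ => (1 - y * q ^ n)⁻¹) atTop (𝓝 (1 - y * 0)⁻¹) :=
    ((hq.const_mul y).const_sub 1).inv₀ (by simp)
  have h2 : Tendsto (fun n : ℕ => (q ^ n - y)⁻¹) atTop (𝓝 (0 - y)⁻¹) :=
    (hq.sub_const y).inv₀ (by simpa using hy0)
  obtain ⟨K1, hK1⟩ := (Metric.isBounded_range_of_tendsto _ h1).exists_norm_le
  obtain ⟨K2, hK2⟩ := (Metric.isBounded_range_of_tendsto _ h2).exists_norm_le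
  refine ⟨max K1 K2, le_max_of_le_left ((norm_nonneg _).trans (hK1 _ ⟨0, rfl⟩)), fun n => ⟨?_, ?_⟩⟩
  · rw [zpow_natCast]
    exact (hK1 _ ⟨n, rfl⟩).trans (le_max_left _ _)
  · have : (1 - y * q ^ (-(n : ℤ)))⁻¹ = (q ^ n - y)⁻¹ * q ^ n := by
      have hn := pow_ne_zero n hq0
      have h3 : 1 - y * q ^ (-(n : ℤ)) = (q ^ n - y) / q ^ n := by
        rw [zpow_neg, zpow_natCast]
        field_simp
      rw [h3, inv_div, div_eq_mul_inv, mul_comm]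
    rw [this, norm_mul, norm_pow]
    exact mul_le_mul_of_nonneg_right ((hK2 _ ⟨n, rfl⟩).trans (le_max_right _ _)) (by positivity)

/-- The nodes grow like `‖q‖ ^ (-|k|)` in both directions. -/
lemma exists_norm_inv_joukowsky_sub_le {q a y : ℂ} (hq0 : q ≠ 0) (hq1 : ‖q‖ < 1) (ha0 : a ≠ 0)
    (hy0 : y ≠ 0) :
    ∃ K, 0 ≤ K ∧ ∀ k : ℤ,
      ‖(joukowsky a (q ^ (-k)) - joukowsky a y)⁻¹‖ ≤ K * ‖q‖ ^ k.natAbs := by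
  obtain ⟨K, hK0, hK⟩ := exists_norm_inv_one_sub_le hq0 hq1 hy0
  obtain ⟨K', hK0', hK'⟩ := exists_norm_inv_one_sub_le hq0 hq1 (div_ne_zero ha0 hy0)
  refine ⟨K * K', mul_nonneg hK0 hK0', fun k => ?_⟩
  rw [joukowsky_zpow_sub hq0 hy0, mul_inv, mul_inv, zpow_neg, inv_inv, norm_mul, norm_mul,
    norm_zpow]
  have hqpos : 0 < ‖q‖ := norm_pos_iff.mpr hq0
  obtain ⟨n, rfl | rfl⟩ := k.eq_nat_or_neg
  · rw [zpow_natCast, Int.natAbs_natCast, mul_comm (K * K')]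
    exact mul_le_mul_of_nonneg_left
      (mul_le_mul (hK n).1 (hK' n).1 (norm_nonneg _) hK0) (by positivity)
  · rw [Int.natAbs_neg, Int.natAbs_natCast, zpow_neg, zpow_natCast]
    calc (‖q‖ ^ n)⁻¹ * (‖(1 - y * q ^ (-(n : ℤ)))⁻¹‖ * ‖(1 - a / y * q ^ (-(n : ℤ)))⁻¹‖)
        ≤ (‖q‖ ^ n)⁻¹ * ((K * ‖q‖ ^ n) * (K' * ‖q‖ ^ n)) := by
          refine mul_le_mul_of_nonneg_left ?_ (by positivity)
          exact mul_le_mul (hK n).2 (hK' n).2 (norm_nonneg _) (by positivity)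
      _ = K * K' * ‖q‖ ^ n := by field_simp

lemma norm_wellPoised_le {q : ℂ} (hq0 : q ≠ 0) (hq1 : ‖q‖ < 1) (a : ℂ) (k : ℤ) :
    ‖q ^ (-k) * (1 - a * q ^ (2 * k))‖ ≤ (1 + ‖a‖) * (‖q‖ ^ k.natAbs)⁻¹ := by
  have hqpos : 0 < ‖q‖ := norm_pos_iff.mpr hq0
  have h : q ^ (-k) * (1 - a * q ^ (2 * k)) = q ^ (-k) - a * q ^ k := by
    rw [two_mul, zpow_add₀ hq0, zpow_neg]
    have := zpow_ne_zero k hq0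
    field_simp
  have key : ∀ m : ℤ, ‖q‖ ^ m ≤ (‖q‖ ^ m.natAbs)⁻¹ := by
    intro m
    rw [← zpow_natCast, ← zpow_neg]
    exact zpow_le_zpow_right_of_le_one₀ hqpos hq1.le (by omega)
  have k1 := key k
  have k2 := key (-k)
  rw [Int.natAbs_neg] at k2
  rw [h]
  refine (norm_sub_le _ _).trans ?_
  rw [norm_mul, norm_zpow, norm_zpow]
  nlinarith [mul_le_mul_of_nonneg_left k1 (norm_nonneg a)]

lemma summable_norm_pow_natAbs {q : ℂ} (hq1 : ‖q‖ < 1) :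
    Summable fun k : ℤ => ‖q‖ ^ k.natAbs := by
  have h := summable_geometric_of_lt_one (norm_nonneg q) hq1
  exact summable_int_iff_summable_nat_and_neg.mpr ⟨by simpa using h, by simpa using h⟩

/-- Over the nodes `w`, the factor `q⁻ᵏ (1 - a q²ᵏ)` grows like `w`, so two factors in the
denominator suffice for geometric convergence in both directions; quotients
`(w - β i) / (w - γ i)` stay bounded. -/
lemma summable_wellPoised {q a y z : ℂ} (hq0 : q ≠ 0) (hq1 : ‖q‖ < 1) (ha0 : a ≠ 0)
    (hy0 : y ≠ 0) (hz0 : z ≠ 0) {ι : Type*} (s : Finset ι) (b c : ι → ℂ)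
    (hc0 : ∀ i ∈ s, c i ≠ 0)
    (hc : ∀ i ∈ s, ∀ k : ℤ, joukowsky a (q ^ (-k)) - joukowsky a (c i) ≠ 0) :
    Summable fun k : ℤ => q ^ (-k) * (1 - a * q ^ (2 * k)) *
      ((joukowsky a (q ^ (-k)) - joukowsky a y)⁻¹ * (joukowsky a (q ^ (-k)) - joukowsky a z)⁻¹ *
        ∏ i ∈ s, (joukowsky a (q ^ (-k)) - joukowsky a (b i)) /
          (joukowsky a (q ^ (-k)) - joukowsky a (c i))) := by
  obtain ⟨K, hK0, hK⟩ := exists_norm_inv_joukowsky_sub_le hq0 hq1 ha0 hy0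
  obtain ⟨K', hK0', hK'⟩ := exists_norm_inv_joukowsky_sub_le hq0 hq1 ha0 hz0
  have hr : ∀ i ∈ s, ∃ R, ∀ k : ℤ, ‖(joukowsky a (q ^ (-k)) - joukowsky a (b i)) /
      (joukowsky a (q ^ (-k)) - joukowsky a (c i))‖ ≤ R := by
    intro i hi
    obtain ⟨R, hR0, hR⟩ := exists_norm_inv_joukowsky_sub_le hq0 hq1 ha0 (hc0 i hi)
    refine ⟨1 + ‖joukowsky a (c i) - joukowsky a (b i)‖ * R, fun k => ?_⟩
    have : (joukowsky a (q ^ (-k)) - joukowsky a (b i)) /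
        (joukowsky a (q ^ (-k)) - joukowsky a (c i)) =
        1 + (joukowsky a (c i) - joukowsky a (b i)) *
          (joukowsky a (q ^ (-k)) - joukowsky a (c i))⁻¹ := by
      have := hc i hi k
      field_simp
      ring
    rw [this]
    refine (norm_add_le _ _).trans ?_
    rw [norm_one, norm_mul]
    gcongr
    exact (hR k).trans (mul_le_of_le_one_right hR0 (pow_le_one₀ (norm_nonneg _) hq1.le))
  choose! R hR using hr
  refine Summable.of_norm_bounded
    (g := fun k : ℤ => (1 + ‖a‖) * (K * K' * ∏ i ∈ s, R i) * ‖q‖ ^ k.natAbs)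
    ((summable_norm_pow_natAbs hq1).mul_left _) fun k => ?_
  have hpos : 0 < ‖q‖ ^ k.natAbs := pow_pos (norm_pos_iff.mpr hq0) _
  rw [norm_mul]
  calc _ ≤ (1 + ‖a‖) * (‖q‖ ^ k.natAbs)⁻¹ *
        ((K * ‖q‖ ^ k.natAbs) * (K' * ‖q‖ ^ k.natAbs) * ∏ i ∈ s, R i) := by
        refine mul_le_mul (norm_wellPoised_le hq0 hq1 a k) ?_ (norm_nonneg _) (by positivity)
        rw [norm_mul, norm_mul, norm_prod]
        exact mul_le_mul (mul_le_mul (hK k) (hK' k) (norm_nonneg _) (by positivity))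
          (Finset.prod_le_prod (fun _ _ => norm_nonneg _) fun i hi => hR i hi k)
          (Finset.prod_nonneg fun _ _ => norm_nonneg _) (by positivity)
    _ = _ := by field_simp

/-! ### Interpolation at the nodes and passage to the limit -/

/-- Lagrange interpolation of `P`, evaluated at a point `ξ` that is not a node. -/
lemma sum_interpolation_weight {ι : Type*} [DecidableEq ι] (s : Finset ι) (w : ι → ℂ)
    (hw : Set.InjOn w s) (P : Polynomial ℂ) (hP : P.degree < s.card) {ξ : ℂ}
    (hξ : ∀ i ∈ s, ξ ≠ w i) :
    ∑ k ∈ s, P.eval (w k) * (w k - ξ)⁻¹ * (∏ i ∈ s.erase k, (w k - w i))⁻¹ =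
      -(P.eval ξ / ∏ i ∈ s, (ξ - w i)) := by
  have h := Lagrange.eval_interpolate_not_at_node (s := s) (v := w) (fun i => P.eval (w i)) hξ
  rw [← Lagrange.eq_interpolate hw hP, Lagrange.eval_nodal] at h
  have h0 : ∏ i ∈ s, (ξ - w i) ≠ 0 :=
    Finset.prod_ne_zero_iff.mpr fun i hi => sub_ne_zero.mpr (hξ i hi)
  rw [h, mul_div_cancel_left₀ _ h0, ← Finset.sum_neg_distrib]
  refine Finset.sum_congr rfl fun k hk => ?_
  rw [Lagrange.nodalWeight, Finset.prod_inv_distrib, ← neg_sub ξ (w k), inv_neg]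
  ring

/-- The integers from `-N` to `N`. -/
noncomputable def window (N : ℕ) : Finset ℤ := Finset.Icc (-(N : ℤ)) N

lemma mem_window {N : ℕ} {k : ℤ} : k ∈ window N ↔ -(N : ℤ) ≤ k ∧ k ≤ N := Finset.mem_Icc

lemma prod_window_add (N M L : ℕ) (k : ℤ) (hM : (M : ℤ) = N + k) (hL : (L : ℤ) = N - k)
    (f : ℤ → ℂ) :
    ∏ j ∈ window N, f (j + k) = ∏ j ∈ Finset.Ico (-(L : ℤ)) (M + 1 : ℕ), f j :=
  Finset.prod_nbij' (fun j => j + k) (fun j => j - k)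
    (fun j hj => by rw [mem_window] at hj; rw [Finset.mem_Ico]; push_cast; omega)
    (fun j hj => by rw [Finset.mem_Ico] at hj; rw [mem_window]; push_cast at hj; omega)
    (fun j _ => by ring) (fun j _ => by ring) (fun j _ => rfl)

lemma prod_window_sub (N M L : ℕ) (k : ℤ) (hM : (M : ℤ) = N + k) (hL : (L : ℤ) = N - k)
    (f : ℤ → ℂ) :
    ∏ j ∈ window N, f (k - j) = ∏ j ∈ Finset.Ico (-(L : ℤ)) (M + 1 : ℕ), f j :=
  Finset.prod_nbij' (fun j => k - j) (fun j => k - j)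
    (fun j hj => by rw [mem_window] at hj; rw [Finset.mem_Ico]; push_cast; omega)
    (fun j hj => by rw [Finset.mem_Ico] at hj; rw [mem_window]; push_cast at hj; omega)
    (fun j _ => by ring) (fun j _ => by ring) (fun j _ => rfl)

lemma prod_window_erase_sub (N M L : ℕ) (k : ℤ) (hM : (M : ℤ) = N + k) (hL : (L : ℤ) = N - k)
    (f : ℤ → ℂ) :
    ∏ j ∈ (window N).erase k, f (k - j) =
      ∏ j ∈ (Finset.Ico (-(L : ℤ)) (M + 1)).erase 0, f j :=
  Finset.prod_nbij' (fun j => k - j) (fun j => k - j)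
    (fun j hj => by
      rw [Finset.mem_erase, mem_window] at hj; rw [Finset.mem_erase, Finset.mem_Ico]; omega)
    (fun j hj => by
      rw [Finset.mem_erase, Finset.mem_Ico] at hj; rw [Finset.mem_erase, mem_window]; omega)
    (fun j _ => by ring) (fun j _ => by ring) (fun j _ => rfl)

/-- For `-N ≤ k ≤ N`, the weight by which the `k`-th term of the bilateral series is multiplied in
the interpolation identity with nodes indexed by `window N`; it is extended by zero. -/
noncomputable def windowWeight (q a c : ℂ) (N : ℕ) (k : ℤ) : ℂ :=
  if k ∈ window N then
    (qPochNat c q ((N + k).toNat + 1) * qPochNat (q / c) q (N - k).toNat *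
      (qPochNat (a / c) q ((N + k).toNat + 1) * qPochNat (q / (a / c)) q (N - k).toNat)) *
    ((qPochNat q q (N + k).toNat)⁻¹ * (qPochNat q q (N - k).toNat)⁻¹ *
      ((qPochNat a q ((N + k).toNat + 1))⁻¹ * (qPochNat (q / a) q (N - k).toNat)⁻¹))
  else 0

lemma prod_joukowsky_sub_window {q a c : ℂ} (hq0 : q ≠ 0) (ha0 : a ≠ 0) (hc0 : c ≠ 0) (N M L : ℕ)
    (k : ℤ) (hM : (M : ℤ) = N + k) (hL : (L : ℤ) = N - k) :
    ∏ j ∈ window N, (joukowsky a (q ^ (-k)) - joukowsky a (c * q ^ j)) =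
      (∏ _j ∈ window N, q ^ (-k)) * (a ^ L * (∏ i ∈ Finset.range L, q ^ (-((i : ℤ) + 1))) ^ 2 *
        (qPochNat c q (M + 1) * qPochNat (q / c) q L *
          (qPochNat (a / c) q (M + 1) * qPochNat (q / (a / c)) q L))) := by
  simp_rw [joukowsky_zpow_sub_shift hq0 hc0, Finset.prod_mul_distrib]
  rw [prod_window_add N M L k hM hL fun j => 1 - c * q ^ j,
    prod_window_sub N M L k hM hL fun j => 1 - a / c * q ^ j, prod_window hq0 hc0,
    prod_window hq0 (div_ne_zero ha0 hc0)]
  have : a ^ L = (-c) ^ L * (-(a / c)) ^ L := by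
    rw [← mul_pow]; congr 1; field_simp
  rw [this]
  ring

lemma prod_joukowsky_sub_node {q a : ℂ} (hq0 : q ≠ 0) (ha0 : a ≠ 0) (N M L : ℕ)
    (k : ℤ) (hM : (M : ℤ) = N + k) (hL : (L : ℤ) = N - k) :
    (∏ j ∈ (window N).erase k, (joukowsky a (q ^ (-k)) - joukowsky a (q ^ (-j)))) *
        (q ^ (-k) * (1 - a * q ^ (2 * k))) =
      (∏ _j ∈ window N, q ^ (-k)) * (a ^ L * (∏ i ∈ Finset.range L, q ^ (-((i : ℤ) + 1))) ^ 2 *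
        (qPochNat q q M * qPochNat q q L * (qPochNat a q (M + 1) * qPochNat (q / a) q L))) := by
  have hk : k ∈ window N := mem_window.mpr (by omega)
  simp_rw [joukowsky_zpow_sub_zpow hq0, Finset.prod_mul_distrib]
  have h1 := Finset.prod_erase_mul (window N) (fun _ => q ^ (-k)) hk
  have h2 := Finset.prod_erase_mul (window N) (fun j => 1 - a * q ^ (k + j)) hk
  have h3 := prod_window_add N M L k hM hL fun j => 1 - a * q ^ j
  simp only [add_comm _ k] at h3
  rw [h3, prod_window hq0 ha0, ← two_mul] at h2
  rw [prod_window_erase_sub N M L k hM hL fun j => 1 - 1 * q ^ j,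
    prod_window_erase hq0 one_ne_zero, one_mul, div_one, ← h1]
  have : a ^ L = (-1) ^ L * (-a) ^ L := by
    rw [← mul_pow]; congr 1; ring
  rw [this]
  linear_combination ((∏ j ∈ (window N).erase k, q ^ (-k)) * q ^ (-k) *
    ((-1) ^ L * (∏ i ∈ Finset.range L, q ^ (-((i : ℤ) + 1))) * (qPochNat q q M * qPochNat q q L)))
     * h2

/-- The product over the nodes in the denominator and the product over the `c qʲ` in the numerator
have the same monomial factors, so their quotient is a quotient of `q`-shifted factorials. -/
lemma windowWeight_eq {q a c : ℂ} (hq0 : q ≠ 0) (hq1 : ‖q‖ < 1) (ha0 : a ≠ 0) (hc0 : c ≠ 0)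
    (ha : ∀ m : ℤ, a ≠ q ^ m) {N : ℕ} {k : ℤ} (hk : k ∈ window N) :
    (∏ j ∈ window N, (joukowsky a (q ^ (-k)) - joukowsky a (c * q ^ j))) *
        (∏ j ∈ (window N).erase k, (joukowsky a (q ^ (-k)) - joukowsky a (q ^ (-j))))⁻¹ =
      q ^ (-k) * (1 - a * q ^ (2 * k)) * windowWeight q a c N k := by
  have hk' := mem_window.mp hk
  have hM : (((N : ℤ) + k).toNat : ℤ) = N + k := Int.toNat_of_nonneg (by omega)
  have hL : (((N : ℤ) - k).toNat : ℤ) = N - k := Int.toNat_of_nonneg (by omega)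
  rw [windowWeight, if_pos hk, prod_joukowsky_sub_window hq0 ha0 hc0 N _ _ k hM hL]
  have h := prod_joukowsky_sub_node (a := a) hq0 ha0 N _ _ k hM hL
  generalize ((N : ℤ) + k).toNat = M at *
  generalize ((N : ℤ) - k).toNat = L at *
  have e1 := qPochNat_ne_zero (one_sub_q_mul_pow_ne_zero hq1) M
  have e2 := qPochNat_ne_zero (one_sub_q_mul_pow_ne_zero hq1) L
  have e3 := qPochNat_ne_zero (one_sub_mul_pow_ne_zero ha) (M + 1)
  have e4 := qPochNat_ne_zero (one_sub_mul_pow_ne_zero (q_div_ne_zpow hq0 ha)) L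
  have e5 : ∏ j ∈ (window N).erase k, (joukowsky a (q ^ (-k)) - joukowsky a (q ^ (-j))) ≠ 0 := by
    refine Finset.prod_ne_zero_iff.mpr fun j hj => sub_ne_zero.mpr fun h => ?_
    exact Finset.ne_of_mem_erase hj (joukowsky_zpow_injective hq0 hq1 ha h).symm
  rw [← div_eq_mul_inv, div_eq_iff e5]
  generalize ∏ j ∈ (window N).erase k, (joukowsky a (q ^ (-k)) - joukowsky a (q ^ (-j))) = X at *
  generalize q ^ (-k) * (1 - a * q ^ (2 * k)) = Y at *
  have hXY : Y * X = X * Y := mul_comm _ _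
  rw [mul_right_comm Y, hXY, h]
  field_simp

lemma exists_norm_windowWeight_le {q a c : ℂ} (hq0 : q ≠ 0) (hq1 : ‖q‖ < 1)
    (ha : ∀ m : ℤ, a ≠ q ^ m) : ∃ K, ∀ N k, ‖windowWeight q a c N k‖ ≤ K := by
  obtain ⟨K1, h1⟩ := exists_norm_qPochNat_le hq1 c
  obtain ⟨K2, h2⟩ := exists_norm_qPochNat_le hq1 (q / c)
  obtain ⟨K3, h3⟩ := exists_norm_qPochNat_le hq1 (a / c)
  obtain ⟨K4, h4⟩ := exists_norm_qPochNat_le hq1 (q / (a / c))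
  obtain ⟨K5, h5⟩ := exists_norm_inv_qPochNat_le hq1 (one_sub_q_mul_pow_ne_zero hq1)
  obtain ⟨K6, h6⟩ := exists_norm_inv_qPochNat_le hq1 (one_sub_mul_pow_ne_zero ha)
  obtain ⟨K7, h7⟩ := exists_norm_inv_qPochNat_le hq1
    (one_sub_mul_pow_ne_zero (q_div_ne_zpow hq0 ha))
  have p1 := (norm_nonneg _).trans (h1 0)
  have p2 := (norm_nonneg _).trans (h2 0)
  have p3 := (norm_nonneg _).trans (h3 0)
  have p4 := (norm_nonneg _).trans (h4 0)
  have p5 := (norm_nonneg _).trans (h5 0)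
  have p6 := (norm_nonneg _).trans (h6 0)
  have p7 := (norm_nonneg _).trans (h7 0)
  refine ⟨K1 * K2 * (K3 * K4) * (K5 * K5 * (K6 * K7)), fun N k => ?_⟩
  rw [windowWeight]
  split_ifs
  · simp only [norm_mul]
    gcongr
    exacts [h1 _, h2 _, h3 _, h4 _, h5 _, h5 _, h6 _, h7 _]
  · rw [norm_zero]
    positivity

lemma tendsto_windowWeight {q a c : ℂ} (hq0 : q ≠ 0) (hq1 : ‖q‖ < 1)
    (ha : ∀ m : ℤ, a ≠ q ^ m) (k : ℤ) :
    Tendsto (fun N => windowWeight q a c N k) atTop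
      (𝓝 (qTheta c q * qTheta (a / c) q / (qPochInf q q ^ 2 * qTheta a q))) := by
  have hM : Tendsto (fun N : ℕ => ((N : ℤ) + k).toNat) atTop atTop :=
    tendsto_atTop.mpr fun b => by
      filter_upwards [eventually_ge_atTop (b + k.natAbs)] with N hN
      omega
  have hL : Tendsto (fun N : ℕ => ((N : ℤ) - k).toNat) atTop atTop :=
    tendsto_atTop.mpr fun b => by
      filter_upwards [eventually_ge_atTop (b + k.natAbs)] with N hN
      omega
  have hM1 : Tendsto (fun N : ℕ => ((N : ℤ) + k).toNat + 1) atTop atTop :=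
    (tendsto_add_atTop_nat 1).comp hM
  have e1 := qPochInf_ne_zero hq1 (one_sub_q_mul_pow_ne_zero hq1)
  have e3 := qPochInf_ne_zero hq1 (one_sub_mul_pow_ne_zero ha)
  have e4 := qPochInf_ne_zero hq1 (one_sub_mul_pow_ne_zero (q_div_ne_zpow hq0 ha))
  have t := fun y => tendsto_qPochNat hq1 y
  have key := ((((t c).comp hM1).mul ((t (q / c)).comp hL)).mul
    (((t (a / c)).comp hM1).mul ((t (q / (a / c))).comp hL))).mul
    (((((t q).comp hM).inv₀ e1).mul (((t q).comp hL).inv₀ e1)).mul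
      ((((t a).comp hM1).inv₀ e3).mul (((t (q / a)).comp hL).inv₀ e4)))
  have hlim : qTheta c q * qTheta (a / c) q / (qPochInf q q ^ 2 * qTheta a q) =
      qPochInf c q * qPochInf (q / c) q * (qPochInf (a / c) q * qPochInf (q / (a / c)) q) *
      ((qPochInf q q)⁻¹ * (qPochInf q q)⁻¹ * ((qPochInf a q)⁻¹ * (qPochInf (q / a) q)⁻¹)) := by
    unfold qTheta
    field_simp
  rw [hlim]
  refine key.congr' ?_
  filter_upwards [eventually_ge_atTop k.natAbs] with N hN
  rw [windowWeight, if_pos (mem_window.mpr (by omega))]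
  rfl

lemma card_window (N : ℕ) : (window N).card = 2 * N + 1 := by
  rw [window, Int.card_Icc]
  omega

/-- Summation of a bilateral series `∑ q⁻ᵏ (1 - a q²ᵏ) φ k` by interpolation: for each large window
the values `φ k`, multiplied by the polynomial with zeros `c qʲ + a / (c qʲ)`, have to be the
values `P N (w k) / (w k - ξ)` of a rational function of the node `w k = q⁻ᵏ + a qᵏ`. Lagrange
interpolation then evaluates the sum over the window with the weights `windowWeight`, and
dominated convergence removes the weights. -/
theorem hasSum_of_interpolation {q a c : ℂ} (hq0 : q ≠ 0) (hq1 : ‖q‖ < 1) (ha0 : a ≠ 0)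
    (hc0 : c ≠ 0) (ha : ∀ m : ℤ, a ≠ q ^ m) (hc : ∀ m : ℤ, c ≠ q ^ m)
    (hac : ∀ m : ℤ, a / c ≠ q ^ m) (φ : ℤ → ℂ)
    (hφ : Summable fun k => q ^ (-k) * (1 - a * q ^ (2 * k)) * φ k)
    (P : ℕ → Polynomial ℂ) (ξ : ℂ) (hξ : ∀ k : ℤ, ξ ≠ joukowsky a (q ^ (-k)))
    (hdeg : ∀ᶠ N in atTop, (P N).natDegree ≤ 2 * N)
    (hP : ∀ᶠ N in atTop, ∀ k ∈ window N,
      φ k * ∏ j ∈ window N, (joukowsky a (q ^ (-k)) - joukowsky a (c * q ^ j)) =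
        (P N).eval (joukowsky a (q ^ (-k))) * (joukowsky a (q ^ (-k)) - ξ)⁻¹)
    {S : ℂ} (hS : Tendsto
      (fun N => -((P N).eval ξ / ∏ i ∈ window N, (ξ - joukowsky a (q ^ (-i))))) atTop (𝓝 S)) :
    HasSum (fun k => q ^ (-k) * (1 - a * q ^ (2 * k)) * φ k)
      (S * (qPochInf q q ^ 2 * qTheta a q) / (qTheta c q * qTheta (a / c) q)) := by
  obtain ⟨K, hK⟩ := exists_norm_windowWeight_le (c := c) hq0 hq1 ha
  -- The weighted sums tend to the full sum, times the limit of the weights.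
  have hdom := tendsto_tsum_of_dominated_convergence (𝓕 := atTop)
    (f := fun N k => windowWeight q a c N k * (q ^ (-k) * (1 - a * q ^ (2 * k)) * φ k))
    (hφ.norm.mul_left K)
    (fun k => (tendsto_windowWeight (c := c) hq0 hq1 ha k).mul_const _)
    (Eventually.of_forall fun N k => by
      rw [norm_mul]
      exact mul_le_mul_of_nonneg_right (hK N k) (norm_nonneg _))
  have hsum : ∀ᶠ N in atTop,
      ∑' k, windowWeight q a c N k * (q ^ (-k) * (1 - a * q ^ (2 * k)) * φ k) =
        -((P N).eval ξ / ∏ i ∈ window N, (ξ - joukowsky a (q ^ (-i)))) := by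
    filter_upwards [hP, hdeg] with N hPN hdegN
    rw [← sum_interpolation_weight (window N) (fun k => joukowsky a (q ^ (-k)))
      (joukowsky_zpow_injective hq0 hq1 ha).injOn (P N) ?_ fun i _ => hξ i]
    · rw [tsum_eq_sum (s := window N) fun k hk => by rw [windowWeight, if_neg hk, zero_mul]]
      refine Finset.sum_congr rfl fun k hk => ?_
      rw [← hPN k hk]
      linear_combination -(φ k) * windowWeight_eq hq0 hq1 ha0 hc0 ha hk
    · rw [card_window]
      refine (Polynomial.degree_le_natDegree).trans_lt ?_
      exact_mod_cast Nat.lt_succ_of_le hdegN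
  have hlim := tendsto_nhds_unique hS (hdom.congr' hsum)
  rw [tsum_mul_left] at hlim
  have n1 := qPochInf_ne_zero hq1 (one_sub_q_mul_pow_ne_zero hq1)
  have n2 : ∀ y : ℂ, (∀ m : ℤ, y ≠ q ^ m) → qTheta y q ≠ 0 := fun y hy =>
    mul_ne_zero (qPochInf_ne_zero hq1 (one_sub_mul_pow_ne_zero hy))
      (qPochInf_ne_zero hq1 (one_sub_mul_pow_ne_zero (q_div_ne_zpow hq0 hy)))
  have n3 := n2 a ha
  have n4 := n2 c hc
  have n5 := n2 _ hac
  convert hφ.hasSum using 1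
  rw [hlim]
  field_simp

/-! ### The two bilateral sums -/

lemma joukowsky_sub {a y z : ℂ} (hy : y ≠ 0) (hz : z ≠ 0) :
    joukowsky a y - joukowsky a z = y * ((1 - z / y) * (1 - a / (y * z))) := by
  unfold joukowsky
  field_simp
  ring

lemma qTheta_inv {q y : ℂ} (hq1 : ‖q‖ < 1) (hy : y ≠ 0) :
    qTheta y⁻¹ q = -(qTheta y q / y) := by
  unfold qTheta
  rw [qPochInf_eq_mul hq1 y⁻¹, qPochInf_eq_mul hq1 y, div_inv_eq_mul, mul_comm q y,
    inv_mul_eq_div]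
  field_simp
  ring

lemma qTheta_ne_zero {q y : ℂ} (hq0 : q ≠ 0) (hq1 : ‖q‖ < 1) (hy : ∀ m : ℤ, y ≠ q ^ m) :
    qTheta y q ≠ 0 :=
  mul_ne_zero (qPochInf_ne_zero hq1 (one_sub_mul_pow_ne_zero hy))
    (qPochInf_ne_zero hq1 (one_sub_mul_pow_ne_zero (q_div_ne_zpow hq0 hy)))

/-- The value of the bilateral series in `hasSum_diagonal`. -/
noncomputable def diagonalSum (q a b c : ℂ) : ℂ :=
  qPochInf (c / b * q) q * qPochInf (q / (c / b)) q *
      (qPochInf (q / (b * c / a)) q * qPochInf (b * c / a * q) q) / (qTheta b q * qTheta (a / b) q) *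
    (qPochInf q q ^ 2 * qTheta a q) / (qTheta c q * qTheta (a / c) q)

lemma prod_joukowsky_sub_zpow {q a b : ℂ} (hq0 : q ≠ 0) (ha0 : a ≠ 0) (hb0 : b ≠ 0) (N : ℕ) :
    ∏ i ∈ window N, (joukowsky a b - joukowsky a (q ^ (-i))) =
      b ^ (2 * N + 1) * ((a / b ^ 2) ^ N * (∏ i ∈ Finset.range N, q ^ (-((i : ℤ) + 1))) ^ 2 *
        (qPochNat b⁻¹ q (N + 1) * qPochNat (q / b⁻¹) q N *
          (qPochNat (a / b) q (N + 1) * qPochNat (q / (a / b)) q N))) := by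
  have h : ∀ i : ℤ, joukowsky a b - joukowsky a (q ^ (-i)) =
      b * ((1 - b⁻¹ * q ^ (0 - i)) * (1 - a / b * q ^ (i + 0))) := fun i => by
    rw [joukowsky_sub hb0 (zpow_ne_zero _ hq0), zero_sub, add_zero, zpow_neg]
    have := zpow_ne_zero i hq0
    field_simp
  simp_rw [h, Finset.prod_mul_distrib]
  rw [prod_window_add N N N 0 (by simp) (by simp) fun j => 1 - a / b * q ^ j,
    prod_window_sub N N N 0 (by simp) (by simp) fun j => 1 - b⁻¹ * q ^ j,
    prod_window hq0 (inv_ne_zero hb0), prod_window hq0 (div_ne_zero ha0 hb0), Finset.prod_const,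
    card_window]
  have : (a / b ^ 2) ^ N = (-b⁻¹) ^ N * (-(a / b)) ^ N := by
    rw [← mul_pow]; congr 1; field_simp
  rw [this]
  ring

lemma prod_joukowsky_sub_erase {q a b c : ℂ} (hq0 : q ≠ 0) (ha0 : a ≠ 0) (hb0 : b ≠ 0)
    (hc0 : c ≠ 0) (N : ℕ) :
    ∏ j ∈ (window N).erase 0, (joukowsky a b - joukowsky a (c * q ^ j)) =
      b ^ (2 * N) * ((a / b ^ 2) ^ N * (∏ i ∈ Finset.range N, q ^ (-((i : ℤ) + 1))) ^ 2 *
        (qPochNat (c / b * q) q N * qPochNat (q / (c / b)) q N *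
          (qPochNat (q / (b * c / a)) q N * qPochNat (b * c / a * q) q N))) := by
  have h : ∀ j : ℤ, joukowsky a b - joukowsky a (c * q ^ j) =
      b * ((1 - c / b * q ^ j) * (1 - a / (b * c) * q ^ (0 - j))) := fun j => by
    rw [joukowsky_sub hb0 (mul_ne_zero hc0 (zpow_ne_zero _ hq0)), zero_sub, zpow_neg]
    have := zpow_ne_zero j hq0
    field_simp
  have h0 : (0 : ℤ) ∈ window N := mem_window.mpr (by omega)
  simp_rw [h, Finset.prod_mul_distrib]
  have hw : (window N).erase 0 = (Finset.Ico (-(N : ℤ)) (N + 1)).erase 0 := by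
    ext j
    simp only [Finset.mem_erase, mem_window, Finset.mem_Ico]
    omega
  rw [prod_window_erase_sub N N N 0 (by simp) (by simp) fun j => 1 - a / (b * c) * q ^ j,
    Finset.prod_const, Finset.card_erase_of_mem h0, card_window, hw,
    prod_window_erase hq0 (div_ne_zero hc0 hb0),
    prod_window_erase hq0 (div_ne_zero ha0 (mul_ne_zero hb0 hc0))]
  have : (a / b ^ 2) ^ N = (-(c / b)) ^ N * (-(a / (b * c))) ^ N := by
    rw [← mul_pow]; congr 1; field_simp
  rw [this, show a / (b * c) * q = q / (b * c / a) by field_simp,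
    show q / (a / (b * c)) = b * c / a * q by field_simp, Nat.add_sub_cancel]
  ring

/-- The interpolated polynomial has the zeros `c qʲ + a / (c qʲ)` for `j ≠ 0` in the window, and it
is evaluated at `b + a / b`; both sides of the interpolation identity become products of
`q`-shifted factorials. -/
theorem hasSum_diagonal {q a b c : ℂ} (hq0 : q ≠ 0) (hq1 : ‖q‖ < 1) (ha0 : a ≠ 0)
    (hb0 : b ≠ 0) (hc0 : c ≠ 0) (ha : ∀ m : ℤ, a ≠ q ^ m) (hb : ∀ m : ℤ, b ≠ q ^ m)
    (hc : ∀ m : ℤ, c ≠ q ^ m) (hab : ∀ m : ℤ, a / b ≠ q ^ m) (hac : ∀ m : ℤ, a / c ≠ q ^ m) :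
    HasSum (fun k : ℤ => q ^ (-k) * (1 - a * q ^ (2 * k)) *
      ((joukowsky a (q ^ (-k)) - joukowsky a b)⁻¹ * (joukowsky a (q ^ (-k)) - joukowsky a c)⁻¹))
      (diagonalSum q a b c) := by
  have h0 : ∀ N, (0 : ℤ) ∈ window N := fun N => mem_window.mpr (by omega)
  refine hasSum_of_interpolation hq0 hq1 ha0 hc0 ha hc hac _ ?_
    (fun N => Lagrange.nodal ((window N).erase 0) fun j => joukowsky a (c * q ^ j))
    (joukowsky a b) ?_ (Eventually.of_forall fun N => ?_) (Eventually.of_forall fun N k _ => ?_) ?_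
  · simpa using summable_wellPoised hq0 hq1 ha0 hb0 hc0 (∅ : Finset ℤ) (fun _ => 1) (fun _ => 1)
      (by simp) (by simp)
  · exact fun k h => joukowsky_zpow_sub_ne_zero hq0 hb0 hb hab k (sub_eq_zero.mpr h.symm)
  · rw [Lagrange.natDegree_nodal, Finset.card_erase_of_mem (h0 N), card_window]
    omega
  · rw [Lagrange.eval_nodal, ← Finset.mul_prod_erase _ _ (h0 N), zpow_zero, mul_one]
    have := joukowsky_zpow_sub_ne_zero hq0 hc0 hc hac k
    field_simp
  · have e1 := qTheta_ne_zero hq0 hq1 (inv_ne_zpow hb)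
    have e2 := qTheta_ne_zero hq0 hq1 hab
    have e3 := qTheta_ne_zero hq0 hq1 hb
    have t := fun y => tendsto_qPochNat hq1 y
    have t' := fun y => (t y).comp (tendsto_add_atTop_nat 1)
    have key := ((((t (c / b * q)).mul (t (q / (c / b)))).mul
      ((t (q / (b * c / a))).mul (t (b * c / a * q)))).div
      (((t' b⁻¹).mul (t (q / b⁻¹))).mul ((t' (a / b)).mul (t (q / (a / b))))) (mul_ne_zero e1 e2)
      ).const_mul (-b⁻¹)
    have hlim : ∀ X : ℂ, X / (qTheta b q * qTheta (a / b) q) =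
        -b⁻¹ * (X / (qTheta b⁻¹ q * qTheta (a / b) q)) := fun X => by
      rw [qTheta_inv hq1 hb0]
      field_simp
    rw [hlim]
    refine key.congr fun N => ?_
    rw [Lagrange.eval_nodal, prod_joukowsky_sub_zpow hq0 ha0 hb0,
      prod_joukowsky_sub_erase hq0 ha0 hb0 hc0]
    have n1 : (a / b ^ 2) ^ N * (∏ i ∈ Finset.range N, q ^ (-((i : ℤ) + 1))) ^ 2 ≠ 0 :=
      mul_ne_zero (pow_ne_zero _ (div_ne_zero ha0 (pow_ne_zero _ hb0)))
        (pow_ne_zero _ (Finset.prod_ne_zero_iff.mpr fun i _ => zpow_ne_zero _ hq0))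
    have n2 : b ^ (2 * N) ≠ 0 := pow_ne_zero _ hb0
    simp only [Function.comp_apply, Pi.div_apply]
    rw [pow_succ b (2 * N), mul_assoc (b ^ (2 * N)), mul_div_mul_left _ _ n2, mul_left_comm b,
      mul_div_mul_left _ _ n1, neg_mul, inv_mul_eq_div,
      div_mul_eq_div_div_swap _ b]

/-- The sum vanishes because the interpolated polynomial has `c qˡ + a / (c qˡ)` among its zeros. -/
theorem hasSum_offDiagonal {q a b c : ℂ} (hq0 : q ≠ 0) (hq1 : ‖q‖ < 1) (ha0 : a ≠ 0)
    (hc0 : c ≠ 0) (ha : ∀ m : ℤ, a ≠ q ^ m) (hc : ∀ m : ℤ, c ≠ q ^ m)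
    (hac : ∀ m : ℤ, a / c ≠ q ^ m) {l n : ℤ} (hln : l < n) :
    HasSum (fun k : ℤ => q ^ (-k) * (1 - a * q ^ (2 * k)) *
      ((joukowsky a (q ^ (-k)) - joukowsky a (c * q ^ l))⁻¹ *
        (joukowsky a (q ^ (-k)) - joukowsky a (c * q ^ n))⁻¹ *
        ∏ i ∈ Finset.Ioo l n, (joukowsky a (q ^ (-k)) - joukowsky a (b * q ^ i)) /
          (joukowsky a (q ^ (-k)) - joukowsky a (c * q ^ i)))) 0 := by
  have hcq0 : ∀ i : ℤ, c * q ^ i ≠ 0 := fun i => mul_ne_zero hc0 (zpow_ne_zero _ hq0)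
  have hne : ∀ i k : ℤ, joukowsky a (q ^ (-k)) - joukowsky a (c * q ^ i) ≠ 0 := fun i k => by
    refine joukowsky_zpow_sub_ne_zero hq0 (hcq0 i) (mul_zpow_ne_zpow hq0 hc i) ?_ k
    rw [show a / (c * q ^ i) = a / c * q ^ (-i) by rw [zpow_neg]; field_simp]
    exact mul_zpow_ne_zpow hq0 hac _
  have hN : ∀ᶠ N : ℕ in atTop, Finset.Icc l n ⊆ window N := by
    filter_upwards [eventually_ge_atTop (l.natAbs + n.natAbs)] with N hN
    intro i hi
    rw [Finset.mem_Icc] at hi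
    exact mem_window.mpr (by omega)
  have hIoc : Finset.Ioc l n = insert n (Finset.Ioo l n) := by
    ext i; simp only [Finset.mem_insert, Finset.mem_Ioc, Finset.mem_Ioo]; omega
  have key := hasSum_of_interpolation (S := 0) hq0 hq1 ha0 hc0 ha hc hac
    (fun k => (joukowsky a (q ^ (-k)) - joukowsky a (c * q ^ l))⁻¹ *
        (joukowsky a (q ^ (-k)) - joukowsky a (c * q ^ n))⁻¹ *
        ∏ i ∈ Finset.Ioo l n, (joukowsky a (q ^ (-k)) - joukowsky a (b * q ^ i)) /
          (joukowsky a (q ^ (-k)) - joukowsky a (c * q ^ i)))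
    (summable_wellPoised hq0 hq1 ha0 (hcq0 l) (hcq0 n) _ _ _ (fun i _ => hcq0 i)
      (fun i _ k => hne i k))
    (fun N => Lagrange.nodal (window N \ Finset.Ioc l n) (fun j => joukowsky a (c * q ^ j)) *
      Lagrange.nodal (Finset.Ioo l n) (fun j => joukowsky a (b * q ^ j)))
    (joukowsky a (c * q ^ l)) (fun k h => hne l k (sub_eq_zero.mpr h.symm)) ?_ ?_ ?_
  · simpa using key
  · filter_upwards [hN] with N hN
    refine Polynomial.natDegree_mul_le.trans ?_
    have hcard := Finset.card_le_card (Finset.Ioc_subset_Icc_self.trans hN)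
    rw [card_window, Int.card_Ioc] at hcard
    rw [Lagrange.natDegree_nodal, Lagrange.natDegree_nodal, Finset.card_sdiff_of_subset
      (Finset.Ioc_subset_Icc_self.trans hN), card_window, Int.card_Ioc, Int.card_Ioo]
    omega
  · filter_upwards [hN] with N hN k _
    rw [Polynomial.eval_mul, Lagrange.eval_nodal, Lagrange.eval_nodal,
      ← Finset.prod_sdiff (Finset.Ioc_subset_Icc_self.trans hN), hIoc,
      Finset.prod_insert (by simp), Finset.prod_div_distrib]
    have h1 := hne n k
    have h2 : ∏ i ∈ Finset.Ioo l n, (joukowsky a (q ^ (-k)) - joukowsky a (c * q ^ i)) ≠ 0 :=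
      Finset.prod_ne_zero_iff.mpr fun i _ => hne i k
    field_simp
  · refine tendsto_const_nhds.congr' ?_
    filter_upwards [hN] with N hN
    have hl : l ∈ window N \ Finset.Ioc l n := by
      rw [Finset.mem_sdiff, Finset.mem_Ioc]
      exact ⟨hN (Finset.left_mem_Icc.mpr hln.le), by omega⟩
    have h0 := Lagrange.eval_nodal_at_node (v := fun j => joukowsky a (c * q ^ j)) hl
    rw [Polynomial.eval_mul, h0, zero_mul, zero_div, neg_zero]

/-! ### `q`-shifted factorials with integer index -/

lemma qPoch_add_one {q y : ℂ} (hy : ∀ m : ℤ, y ≠ q ^ m) (n : ℤ) :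
    qPoch y q (n + 1) = qPoch y q n * (1 - y * q ^ n) := by
  match n with
  | Int.ofNat n =>
    change ∏ i ∈ Finset.range (n + 1), (1 - y * q ^ i) = _
    rw [Finset.prod_range_succ, Int.ofNat_eq_natCast, zpow_natCast]
    rfl
  | Int.negSucc 0 =>
    have h := one_sub_mul_zpow_ne_zero hy (-1)
    have e : qPoch y q (Int.negSucc 0) = (1 - y * q ^ (-1 : ℤ))⁻¹ := by simp [qPoch]
    have e0 : qPoch y q (Int.negSucc 0 + 1) = 1 := by
      change ∏ i ∈ Finset.range 0, (1 - y * q ^ i) = 1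
      simp
    rw [e0, e]
    exact (inv_mul_cancel₀ h).symm
  | Int.negSucc (m + 1) =>
    have h := one_sub_mul_zpow_ne_zero hy (Int.negSucc (m + 1))
    have e : (Int.negSucc (m + 1)) = -(((m + 1 : ℕ) : ℤ) + 1) := by omega
    have e' : Int.negSucc (m + 1) + 1 = Int.negSucc m := by omega
    rw [e']
    simp only [qPoch]
    rw [Finset.prod_range_succ _ (m + 1), mul_inv, ← e, inv_mul_cancel_right₀ h]

lemma qPoch_zero (y q : ℂ) : qPoch y q 0 = 1 := by
  change ∏ i ∈ Finset.range 0, (1 - y * q ^ i) = 1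
  simp

lemma qPoch_ne_zero {q y : ℂ} (hy : ∀ m : ℤ, y ≠ q ^ m) (n : ℤ) : qPoch y q n ≠ 0 := by
  match n with
  | Int.ofNat n =>
    exact Finset.prod_ne_zero_iff.mpr fun i _ => one_sub_mul_pow_ne_zero hy i
  | Int.negSucc m =>
    exact inv_ne_zero (Finset.prod_ne_zero_iff.mpr fun i _ => one_sub_mul_zpow_ne_zero hy _)

lemma qPoch_mul_q {q y : ℂ} (hq0 : q ≠ 0) (hy : ∀ m : ℤ, y ≠ q ^ m) (n : ℤ) :
    qPoch (y * q) q n = qPoch y q (n + 1) / (1 - y) := by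
  have hyq : ∀ m : ℤ, y * q ≠ q ^ m := by simpa using mul_zpow_ne_zpow hq0 hy 1
  have h1 : 1 - y ≠ 0 := by simpa using one_sub_mul_zpow_ne_zero hy 0
  have hstep : ∀ n : ℤ, 1 - y * q * q ^ n = 1 - y * q ^ (n + 1) := fun n => by
    rw [zpow_add_one₀ hq0]; ring
  induction n using Int.induction_on with
  | zero => rw [qPoch_add_one hy, qPoch_zero, qPoch_zero, zpow_zero, mul_one, one_mul, div_self h1]
  | succ n ih => rw [qPoch_add_one hyq, ih, qPoch_add_one hy (n + 1), hstep]; ring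
  | pred n ih =>
    have e := qPoch_add_one hyq (-(n : ℤ) - 1)
    have e' := qPoch_add_one hy (-(n : ℤ) - 1 + 1)
    rw [hstep] at e
    rw [sub_add_cancel] at e e' ⊢
    rw [ih, e', mul_div_right_comm] at e
    exact (mul_right_cancel₀ (one_sub_mul_zpow_ne_zero hy _) e).symm

/-- The reflection `(y; q)_n (q / y; q)_{-n} = (-y)ⁿ q^{n(n-1)/2}`, with the power of `q` eliminated
by taking a quotient. -/
lemma qPoch_div_qPoch {q y z : ℂ} (hq0 : q ≠ 0) (hy0 : y ≠ 0) (hz0 : z ≠ 0)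
    (hy : ∀ m : ℤ, y ≠ q ^ m) (hz : ∀ m : ℤ, z ≠ q ^ m) (n : ℤ) :
    qPoch y q n / qPoch z q n =
      (y / z) ^ n * (qPoch (q / z) q (-n) / qPoch (q / y) q (-n)) := by
  have step : ∀ {y : ℂ}, y ≠ 0 → (∀ m : ℤ, y ≠ q ^ m) → ∀ n : ℤ,
      qPoch y q (n + 1) * qPoch (q / y) q (-(n + 1)) * q ^ (-n) =
        -y * (qPoch y q n * qPoch (q / y) q (-n)) := by
    intro y hy0 hy n
    have h := qPoch_add_one (q_div_ne_zpow hq0 hy) (-(n + 1))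
    rw [neg_add, neg_add_cancel_right] at h
    rw [qPoch_add_one hy, h, neg_add, zpow_add₀ hq0, zpow_neg, zpow_neg, zpow_one]
    have := zpow_ne_zero n hq0
    field_simp
    ring
  have hq : ∀ n : ℤ, q ^ (-n) ≠ 0 := fun n => zpow_ne_zero _ hq0
  have key : ∀ n : ℤ, qPoch y q n * qPoch (q / y) q (-n) =
      (y / z) ^ n * (qPoch z q n * qPoch (q / z) q (-n)) := by
    intro n
    have hyz : y / z ≠ 0 := div_ne_zero hy0 hz0
    induction n using Int.induction_on with
    | zero => simp [qPoch_zero]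
    | succ n ih =>
      refine mul_right_cancel₀ (hq n) ?_
      rw [step hy0 hy, mul_assoc, step hz0 hz, ih, zpow_add_one₀ hyz]
      field_simp
    | pred n ih =>
      have e1 := step hy0 hy (-(n : ℤ) - 1)
      have e2 := step hz0 hz (-(n : ℤ) - 1)
      rw [sub_add_cancel] at e1 e2
      refine mul_left_cancel₀ (neg_ne_zero.mpr hy0) ?_
      have e3 : (y / z) ^ (-(n : ℤ)) = (y / z) ^ (-(n : ℤ) - 1) * (y / z) := by
        rw [← zpow_add_one₀ hyz, sub_add_cancel]
      rw [e3] at ih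
      have hyz' : y / z * z = y := div_mul_cancel₀ y hz0
      rw [← e1, ih]
      linear_combination (y / z) ^ (-(n : ℤ) - 1) * (y / z) * e2 -
        (y / z) ^ (-(n : ℤ) - 1) *
          (qPoch z q (-(n : ℤ) - 1) * qPoch (q / z) q (-(-(n : ℤ) - 1))) * hyz'
  rw [← mul_div_assoc, div_eq_div_iff (qPoch_ne_zero hz n)
    (qPoch_ne_zero (q_div_ne_zpow hq0 hy) _), key]
  ring

lemma Ioo_succ_right_eq_insert {l n : ℤ} (h : l + 1 ≤ n) :
    Finset.Ioo l (n + 1) = insert n (Finset.Ioo l n) := by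
  ext i; simp only [Finset.mem_insert, Finset.mem_Ioo]; omega

lemma qPoch_add_eq_mul_prod {q y : ℂ} (hy : ∀ m : ℤ, y ≠ q ^ m) (k : ℤ) {l n : ℤ} (h : l < n) :
    qPoch y q (n + k) =
      qPoch y q (l + k + 1) * ∏ i ∈ Finset.Ioo l n, (1 - y * q ^ (i + k)) := by
  induction n, Int.add_one_le_of_lt h using Int.leInduction with
  | base => rw [show l + 1 + k = l + k + 1 by ring, Finset.prod_eq_one, mul_one]
            intro i hi; rw [Finset.mem_Ioo] at hi; omega
  | succ n hn ih =>
    rw [Ioo_succ_right_eq_insert hn, Finset.prod_insert (by simp),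
      show n + 1 + k = n + k + 1 by ring, qPoch_add_one hy, ih (by omega)]
    ring

lemma qPoch_sub_eq_mul_prod {q y : ℂ} (hy : ∀ m : ℤ, y ≠ q ^ m) (k : ℤ) {l n : ℤ} (h : l < n) :
    qPoch y q (k - l) =
      qPoch y q (k - n + 1) * ∏ i ∈ Finset.Ioo l n, (1 - y * q ^ (k - i)) := by
  induction n, Int.add_one_le_of_lt h using Int.leInduction with
  | base => rw [show k - (l + 1) + 1 = k - l by ring, Finset.prod_eq_one, mul_one]
            intro i hi; rw [Finset.mem_Ioo] at hi; omega
  | succ n hn ih =>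
    rw [Ioo_succ_right_eq_insert hn, Finset.prod_insert (by simp),
      show k - (n + 1) + 1 = k - n by ring, ih (by omega), qPoch_add_one hy]
    ring

/-! ### The general term of the matrix product -/

/-- The entry product `schlosserA q a b c n k * schlosserB q a b c k l`, up to a factor that does not
depend on `k`. It is symmetric under exchanging `(b, n)` with `(c, l)`. -/
noncomputable def productTerm (q a b c : ℂ) (n l k : ℤ) : ℂ :=
  q ^ k * (1 - a * q ^ (2 * k)) *
    (qPoch b q (n + k) / qPoch b q (l + k + 1) * (qPoch c q (l + k) / qPoch c q (n + k + 1)) *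
      (qPoch (a / c) q (k - n) / qPoch (a / c) q (k - l + 1) *
        (qPoch (a / b) q (k - l) / qPoch (a / b) q (k - n + 1))))

lemma productTerm_swap (q a b c : ℂ) (n l k : ℤ) :
    productTerm q a b c n l k = productTerm q a c b l n k := by
  unfold productTerm
  ring

lemma hasSum_productTerm_of_lt {q a b c : ℂ} (hq0 : q ≠ 0) (hq1 : ‖q‖ < 1) (ha0 : a ≠ 0)
    (hb0 : b ≠ 0) (hc0 : c ≠ 0) (ha : ∀ m : ℤ, a ≠ q ^ m) (hb : ∀ m : ℤ, b ≠ q ^ m)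
    (hc : ∀ m : ℤ, c ≠ q ^ m) (hab : ∀ m : ℤ, a / b ≠ q ^ m) (hac : ∀ m : ℤ, a / c ≠ q ^ m)
    {n l : ℤ} (hln : l < n) : HasSum (productTerm q a b c n l) 0 := by
  convert hasSum_offDiagonal (b := b) hq0 hq1 ha0 hc0 ha hc hac hln using 2 with k
  have hprod : ∏ i ∈ Finset.Ioo l n, (joukowsky a (q ^ (-k)) - joukowsky a (b * q ^ i)) /
        (joukowsky a (q ^ (-k)) - joukowsky a (c * q ^ i)) =
      (∏ i ∈ Finset.Ioo l n, (1 - b * q ^ (i + k))) *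
        (∏ i ∈ Finset.Ioo l n, (1 - a / b * q ^ (k - i))) /
      ((∏ i ∈ Finset.Ioo l n, (1 - c * q ^ (i + k))) *
        (∏ i ∈ Finset.Ioo l n, (1 - a / c * q ^ (k - i)))) := by
    rw [← Finset.prod_mul_distrib, ← Finset.prod_mul_distrib, ← Finset.prod_div_distrib]
    refine Finset.prod_congr rfl fun i _ => ?_
    rw [joukowsky_zpow_sub_shift hq0 hb0, joukowsky_zpow_sub_shift hq0 hc0,
      mul_div_mul_left _ _ (zpow_ne_zero _ hq0)]
  have p1 : ∏ i ∈ Finset.Ioo l n, (1 - c * q ^ (i + k)) ≠ 0 :=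
    Finset.prod_ne_zero_iff.mpr fun i _ => one_sub_mul_zpow_ne_zero hc _
  have p2 : ∏ i ∈ Finset.Ioo l n, (1 - a / c * q ^ (k - i)) ≠ 0 :=
    Finset.prod_ne_zero_iff.mpr fun i _ => one_sub_mul_zpow_ne_zero hac _
  rw [hprod, productTerm, qPoch_add_one hc (n + k), qPoch_add_eq_mul_prod hb k hln,
    qPoch_add_eq_mul_prod hc k hln, qPoch_add_one hc (l + k), qPoch_add_one hac (k - l),
    qPoch_sub_eq_mul_prod hac k hln, qPoch_sub_eq_mul_prod hab k hln, qPoch_add_one hac (k - n),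
    joukowsky_zpow_sub_shift hq0 hc0, joukowsky_zpow_sub_shift hq0 hc0, zpow_neg]
  have h1 := qPoch_ne_zero hb (l + k + 1)
  have h2 := qPoch_ne_zero hc (l + k)
  have h3 := qPoch_ne_zero hac (k - n)
  have h4 := qPoch_ne_zero hab (k - n + 1)
  have h5 := one_sub_mul_zpow_ne_zero hc (l + k)
  have h6 := one_sub_mul_zpow_ne_zero hc (n + k)
  have h7 := one_sub_mul_zpow_ne_zero hac (k - l)
  have h8 := one_sub_mul_zpow_ne_zero hac (k - n)
  have h9 := zpow_ne_zero k hq0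
  -- The factors are made atomic, so that `field_simp` does not look inside them.
  generalize 1 - c * q ^ (l + k) = x1 at *
  generalize 1 - c * q ^ (n + k) = x2 at *
  generalize 1 - a / c * q ^ (k - l) = x3 at *
  generalize 1 - a / c * q ^ (k - n) = x4 at *
  generalize ∏ i ∈ Finset.Ioo l n, (1 - a / c * q ^ (k - i)) = x5 at *
  generalize ∏ i ∈ Finset.Ioo l n, (1 - a / b * q ^ (k - i)) = x6 at *
  generalize qPoch (a / c) q (k - n) = x7 at *
  generalize qPoch (a / b) q (k - n + 1) = x8 at *
  generalize 1 - a * q ^ (2 * k) = x9 at *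
  field_simp

lemma hasSum_productTerm_of_ne {q a b c : ℂ} (hq0 : q ≠ 0) (hq1 : ‖q‖ < 1) (ha0 : a ≠ 0)
    (hb0 : b ≠ 0) (hc0 : c ≠ 0) (ha : ∀ m : ℤ, a ≠ q ^ m) (hb : ∀ m : ℤ, b ≠ q ^ m)
    (hc : ∀ m : ℤ, c ≠ q ^ m) (hab : ∀ m : ℤ, a / b ≠ q ^ m) (hac : ∀ m : ℤ, a / c ≠ q ^ m)
    {n l : ℤ} (hln : n ≠ l) : HasSum (productTerm q a b c n l) 0 := by
  rcases lt_or_gt_of_ne hln with h | h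
  · rw [funext (productTerm_swap q a b c n l)]
    exact hasSum_productTerm_of_lt hq0 hq1 ha0 hc0 hb0 ha hc hb hac hab h
  · exact hasSum_productTerm_of_lt hq0 hq1 ha0 hb0 hc0 ha hb hc hab hac h

lemma hasSum_productTerm_self {q a b c : ℂ} (hq0 : q ≠ 0) (hq1 : ‖q‖ < 1) (ha0 : a ≠ 0)
    (hb0 : b ≠ 0) (hc0 : c ≠ 0) (ha : ∀ m : ℤ, a ≠ q ^ m) (hb : ∀ m : ℤ, b ≠ q ^ m)
    (hc : ∀ m : ℤ, c ≠ q ^ m) (hab : ∀ m : ℤ, a / b ≠ q ^ m) (hac : ∀ m : ℤ, a / c ≠ q ^ m)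
    (n : ℤ) : HasSum (productTerm q a b c n n) (diagonalSum q a (b * q ^ n) (c * q ^ n)) := by
  have hbn := mul_zpow_ne_zpow hq0 hb n
  have hcn := mul_zpow_ne_zpow hq0 hc n
  have hdiv : ∀ y : ℂ, a / (y * q ^ n) = a / y * q ^ (-n) := fun y => by
    rw [zpow_neg, ← div_div, div_eq_mul_inv (a / y)]
  have habn : ∀ m : ℤ, a / (b * q ^ n) ≠ q ^ m := by
    rw [hdiv]; exact mul_zpow_ne_zpow hq0 hab _
  have hacn : ∀ m : ℤ, a / (c * q ^ n) ≠ q ^ m := by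
    rw [hdiv]; exact mul_zpow_ne_zpow hq0 hac _
  have hn := zpow_ne_zero n hq0
  convert hasSum_diagonal hq0 hq1 ha0 (mul_ne_zero hb0 hn) (mul_ne_zero hc0 hn) ha hbn hcn habn
    hacn using 2 with k
  rw [productTerm, qPoch_add_one hb, qPoch_add_one hc, qPoch_add_one hac, qPoch_add_one hab,
    joukowsky_zpow_sub_shift hq0 hb0, joukowsky_zpow_sub_shift hq0 hc0, zpow_neg]
  have h1 := qPoch_ne_zero hb (n + k)
  have h2 := qPoch_ne_zero hc (n + k)
  have h3 := qPoch_ne_zero hac (k - n)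
  have h4 := qPoch_ne_zero hab (k - n)
  have h5 := one_sub_mul_zpow_ne_zero hc (n + k)
  have h6 := one_sub_mul_zpow_ne_zero hb (n + k)
  have h7 := one_sub_mul_zpow_ne_zero hac (k - n)
  have h8 := one_sub_mul_zpow_ne_zero hab (k - n)
  have h9 := zpow_ne_zero k hq0
  generalize 1 - c * q ^ (n + k) = x1 at *
  generalize 1 - b * q ^ (n + k) = x2 at *
  generalize 1 - a / c * q ^ (k - n) = x3 at *
  generalize 1 - a / b * q ^ (k - n) = x4 at *
  generalize qPoch (a / c) q (k - n) = x7 at *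
  generalize qPoch (a / b) q (k - n) = x8 at *
  generalize 1 - a * q ^ (2 * k) = x9 at *
  field_simp

/-! ### Normalization of the diagonal entries -/

lemma qTheta_eq_mul {q : ℂ} (hq1 : ‖q‖ < 1) (y : ℂ) :
    qTheta y q = (1 - y) * (qPochInf (y * q) q * qPochInf (q / y) q) := by
  rw [qTheta, qPochInf_eq_mul hq1 y, mul_assoc]

/-- The quotient of theta functions on which the diagonal sums depend. -/
noncomputable def thetaQuotient (q a b c : ℂ) : ℂ :=
  qTheta (b * c / a) q / (qTheta b q * qTheta (a / b) q * (qTheta c q * qTheta (a / c) q))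

lemma diagonalSum_mul {q a b c : ℂ} (hq1 : ‖q‖ < 1) :
    diagonalSum q a b c * (1 - b * c / a) =
      qPochInf (c / b * q) q * qPochInf (q / (c / b)) q * (qPochInf q q ^ 2 * qTheta a q) *
        thetaQuotient q a b c := by
  rw [diagonalSum, thetaQuotient, qTheta_eq_mul hq1 (b * c / a)]
  simp only [div_eq_mul_inv, mul_inv]
  ring

/-- The theta functions in the numerator and the denominator have the same degree under the
simultaneous shift of `b` and `c`, so only a factor `q` is left of their quasi-periodicity factors. -/
lemma thetaQuotient_mul_q {q a b c : ℂ} (hq0 : q ≠ 0) (hq1 : ‖q‖ < 1) (ha0 : a ≠ 0)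
    (hb0 : b ≠ 0) (hc0 : c ≠ 0) :
    thetaQuotient q a (b * q) (c * q) = q * thetaQuotient q a b c := by
  have h1 : ∀ y : ℂ, y ≠ 0 → qTheta (a / (y * q)) q = -(qTheta (a / y) q * a / (y * q)) := by
    intro y hy
    have h := qTheta_mul_q hq0 hq1 (div_ne_zero ha0 (mul_ne_zero hy hq0))
    rw [show a / (y * q) * q = a / y by field_simp] at h
    rw [h]
    field_simp
  have hA : b * c / a ≠ 0 := div_ne_zero (mul_ne_zero hb0 hc0) ha0
  have h2 : qTheta (b * q * (c * q) / a) q =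
      qTheta (b * c / a) q / (b * c / a * (b * c / a * q)) := by
    rw [show b * q * (c * q) / a = b * c / a * q * q by ring,
      qTheta_mul_q hq0 hq1 (mul_ne_zero hA hq0), qTheta_mul_q hq0 hq1 hA]
    field_simp
  rw [thetaQuotient, thetaQuotient, h1 b hb0, h1 c hc0, h2, qTheta_mul_q hq0 hq1 hb0,
    qTheta_mul_q hq0 hq1 hc0]
  generalize qTheta (b * c / a) q = X
  simp only [div_eq_mul_inv, mul_inv, inv_neg, inv_inv]
  field_simp

lemma thetaQuotient_mul_zpow {q a b c : ℂ} (hq0 : q ≠ 0) (hq1 : ‖q‖ < 1) (ha0 : a ≠ 0)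
    (hb0 : b ≠ 0) (hc0 : c ≠ 0) (n : ℤ) :
    thetaQuotient q a (b * q ^ n) (c * q ^ n) = q ^ n * thetaQuotient q a b c := by
  have step := fun m : ℤ => thetaQuotient_mul_q hq0 hq1 ha0
    (mul_ne_zero hb0 (zpow_ne_zero m hq0)) (mul_ne_zero hc0 (zpow_ne_zero m hq0))
  simp_rw [mul_assoc, ← zpow_add_one₀ hq0] at step
  induction n using Int.induction_on with
  | zero => simp
  | succ n ih => rw [step, ih, zpow_add_one₀ hq0]; ring
  | pred n ih =>
    have h := step (-(n : ℤ) - 1)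
    rw [sub_add_cancel, ih] at h
    refine mul_left_cancel₀ hq0 (h.symm.trans ?_)
    rw [← mul_assoc, mul_comm q, ← zpow_add_one₀ hq0, sub_add_cancel]

/-- The prefactor of `A` normalizes the diagonal sum: up to elementary factors the two are
reciprocal. -/
lemma schlosserPrefactor_mul {q a b c : ℂ} (hq0 : q ≠ 0) (hq1 : ‖q‖ < 1)
    (ha : ∀ m : ℤ, a ≠ q ^ m) (hb : ∀ m : ℤ, b ≠ q ^ m) (hc : ∀ m : ℤ, c ≠ q ^ m)
    (hab : ∀ m : ℤ, a / b ≠ q ^ m) (hac : ∀ m : ℤ, a / c ≠ q ^ m)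
    (hbca : ∀ m : ℤ, b * c / a ≠ q ^ m) (hbc : ∀ m : ℤ, m ≠ 0 → b / c ≠ q ^ m) :
    schlosserPrefactor q a b c * ((1 - b) * (1 - a / b) * ((1 - c) * (1 - a / c))) *
      (qPochInf (c / b * q) q * qPochInf (q / (c / b)) q * (qPochInf q q ^ 2 * qTheta a q) *
        thetaQuotient q a b c) = (1 - a) * (1 - b * c / a) := by
  have n0 := qPochInf_ne_zero hq1 (one_sub_q_mul_pow_ne_zero hq1)
  have na := qTheta_ne_zero hq0 hq1 ha
  have nb := qTheta_ne_zero hq0 hq1 hb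
  have nc := qTheta_ne_zero hq0 hq1 hc
  have nab := qTheta_ne_zero hq0 hq1 hab
  have nac := qTheta_ne_zero hq0 hq1 hac
  have nbca := qTheta_ne_zero hq0 hq1 hbca
  have n1 : qPochInf (b * q / c) q ≠ 0 := qPochInf_ne_zero hq1 fun i h => by
    refine hbc (-((i : ℤ) + 1)) (by omega) ?_
    rw [zpow_neg, zpow_add_one₀ hq0, zpow_natCast]
    exact eq_inv_of_mul_eq_one_left (by linear_combination -h)
  have n2 : qPochInf (c * q / b) q ≠ 0 := qPochInf_ne_zero hq1 fun i h => by
    refine hbc ((i : ℤ) + 1) (by omega) ?_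
    rw [zpow_add_one₀ hq0, zpow_natCast, ← inv_div]
    exact (eq_inv_of_mul_eq_one_right (by linear_combination -h)).symm
  have r1 : ∀ x y : ℂ, x / y * q = x * q / y := fun x y => div_mul_eq_mul_div x y q
  have r2 : ∀ x y : ℂ, q / (x / y) = y * q / x := fun x y => by rw [div_div_eq_mul_div, mul_comm]
  rw [qTheta_eq_mul hq1] at na nb nc nab nac nbca
  rw [thetaQuotient, schlosserPrefactor, qTheta_eq_mul hq1 a, qTheta_eq_mul hq1 b,
    qTheta_eq_mul hq1 c, qTheta_eq_mul hq1 (a / b), qTheta_eq_mul hq1 (a / c),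
    qTheta_eq_mul hq1 (b * c / a)]
  rw [r1, r2] at nab nac nbca
  simp only [r1, r2]
  simp only [mul_ne_zero_iff] at na nb nc nab nac nbca
  obtain ⟨na1, na2, na3⟩ := na
  obtain ⟨nb1, nb2, nb3⟩ := nb
  obtain ⟨nc1, nc2, nc3⟩ := nc
  obtain ⟨nab1, nab2, nab3⟩ := nab
  obtain ⟨nac1, nac2, nac3⟩ := nac
  obtain ⟨nbca1, nbca2, nbca3⟩ := nbca
  -- The factors are made atomic, so that `field_simp` does not look inside them.
  generalize qPochInf (b * q / c) q = x1 at *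
  generalize qPochInf (c * q / b) q = x2 at *
  generalize qPochInf (a * q / b) q = x3 at *
  generalize qPochInf (b * q / a) q = x4 at *
  generalize qPochInf (a * q / c) q = x5 at *
  generalize qPochInf (c * q / a) q = x6 at *
  generalize qPochInf (a * q / (b * c)) q = x7 at *
  generalize qPochInf (b * c * q / a) q = x8 at *
  generalize qPochInf (a * q) q = x9 at *
  generalize qPochInf (b * q) q = z1 at *
  generalize qPochInf (c * q) q = z2 at *
  generalize qPochInf (q / a) q = y1 at *
  generalize qPochInf (q / b) q = y2 at *
  generalize qPochInf (q / c) q = y3 at *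
  generalize 1 - a / b = y4 at *
  generalize 1 - a / c = y5 at *
  generalize 1 - b * c / a = y6 at *
  generalize 1 - a = y7 at *
  generalize 1 - b = y8 at *
  generalize 1 - c = y9 at *
  field_simp

/-! ### The two matrix products -/

lemma schlosserA_mul_schlosserB {q a b c : ℂ} (hq0 : q ≠ 0) (hb : ∀ m : ℤ, b ≠ q ^ m)
    (hc : ∀ m : ℤ, c ≠ q ^ m) (hab : ∀ m : ℤ, a / b ≠ q ^ m) (hac : ∀ m : ℤ, a / c ≠ q ^ m)
    (n l k : ℤ) :
    schlosserA q a b c n k * schlosserB q a b c k l =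
      schlosserPrefactor q a b c * ((1 - b) * (1 - a / b) * ((1 - c) * (1 - a / c))) *
        ((1 - b * c * q ^ (2 * n) / a) / (1 - b * c / a) / (1 - a) * q ^ (-l)) *
        productTerm q a b c n l k := by
  have r1 : ∀ x y : ℂ, x * q / y = x / y * q := fun x y => (div_mul_eq_mul_div x y q).symm
  rw [schlosserA, schlosserB, productTerm, r1 a b, r1 a c, qPoch_mul_q hq0 hb,
    qPoch_mul_q hq0 hc, qPoch_mul_q hq0 hab, qPoch_mul_q hq0 hac, sub_eq_add_neg k l,
    zpow_add₀ hq0, add_comm k l]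
  simp only [div_eq_mul_inv, mul_inv, inv_inv]
  ring

lemma hasSum_schlosserA_mul_schlosserB {q a b c : ℂ} (hq0 : q ≠ 0) (hq1 : ‖q‖ < 1)
    (ha0 : a ≠ 0) (hb0 : b ≠ 0) (hc0 : c ≠ 0)
    (ha : ∀ m : ℤ, a ≠ q ^ m) (hb : ∀ m : ℤ, b ≠ q ^ m) (hc : ∀ m : ℤ, c ≠ q ^ m)
    (hab : ∀ m : ℤ, a / b ≠ q ^ m) (hac : ∀ m : ℤ, a / c ≠ q ^ m)
    (hbca : ∀ m : ℤ, b * c / a ≠ q ^ m) (hbc : ∀ m : ℤ, m ≠ 0 → b / c ≠ q ^ m) (n l : ℤ) :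
    HasSum (fun k : ℤ => schlosserA q a b c n k * schlosserB q a b c k l)
      ((1 : Matrix ℤ ℤ ℂ) n l) := by
  simp_rw [schlosserA_mul_schlosserB hq0 hb hc hab hac]
  by_cases hnl : n = l
  · subst hnl
    have hn := zpow_ne_zero n hq0
    have hD := diagonalSum_mul (a := a) (b := b * q ^ n) (c := c * q ^ n) hq1
    rw [thetaQuotient_mul_zpow hq0 hq1 ha0 hb0 hc0, mul_div_mul_right _ _ hn,
      show b * q ^ n * (c * q ^ n) / a = b * c * q ^ (2 * n) / a by
        rw [two_mul, zpow_add₀ hq0]; ring] at hD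
    have hP := schlosserPrefactor_mul hq0 hq1 ha hb hc hab hac hbca hbc
    have h1 : 1 - a ≠ 0 := by simpa using one_sub_mul_zpow_ne_zero ha 0
    have h2 : 1 - b * c / a ≠ 0 := by simpa using one_sub_mul_zpow_ne_zero hbca 0
    have hval : schlosserPrefactor q a b c * ((1 - b) * (1 - a / b) * ((1 - c) * (1 - a / c))) *
        ((1 - b * c * q ^ (2 * n) / a) / (1 - b * c / a) / (1 - a) * q ^ (-n)) *
        diagonalSum q a (b * q ^ n) (c * q ^ n) = 1 := by
      rw [zpow_neg]
      generalize schlosserPrefactor q a b c *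
        ((1 - b) * (1 - a / b) * ((1 - c) * (1 - a / c))) = X at *
      generalize diagonalSum q a (b * q ^ n) (c * q ^ n) = D at *
      generalize 1 - b * c * q ^ (2 * n) / a = Y at *
      generalize 1 - b * c / a = Z at *
      generalize 1 - a = W at *
      field_simp
      linear_combination (q ^ n) * hP + X * hD
    have h := (hasSum_productTerm_self hq0 hq1 ha0 hb0 hc0 ha hb hc hab hac n).mul_left
      (schlosserPrefactor q a b c * ((1 - b) * (1 - a / b) * ((1 - c) * (1 - a / c))) *
        ((1 - b * c * q ^ (2 * n) / a) / (1 - b * c / a) / (1 - a) * q ^ (-n)))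
    rw [hval] at h
    rwa [Matrix.one_apply_eq]
  · rw [Matrix.one_apply_ne hnl]
    simpa using (hasSum_productTerm_of_ne hq0 hq1 ha0 hb0 hc0 ha hb hc hab hac hnl).mul_left _

/-- The substitution `(a, b, c) ↦ (b c / a, c, b)` turns `B` into `A`, up to a diagonal
conjugation. -/
lemma schlosserA_dual {q a b c : ℂ} (hq0 : q ≠ 0) (ha0 : a ≠ 0) (hb0 : b ≠ 0) (hc0 : c ≠ 0)
    (hab : ∀ m : ℤ, a / b ≠ q ^ m) (hac : ∀ m : ℤ, a / c ≠ q ^ m) (n k : ℤ) :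
    schlosserA q (b * c / a) c b n k =
      schlosserPrefactor q a b c * (c / b) ^ (k - n) * schlosserB q a b c n k := by
  have hP : schlosserPrefactor q (b * c / a) c b = schlosserPrefactor q a b c := by
    unfold schlosserPrefactor
    rw [show b * c / a * q / c = b * q / a by field_simp,
      show c * q / (b * c / a) = a * q / b by field_simp,
      show b * c / a * q / b = c * q / a by field_simp,
      show b * q / (b * c / a) = a * q / c by field_simp,
      show b * c / a * q = b * c * q / a by ring,
      show q / (b * c / a) = a * q / (b * c) by field_simp,
      show b * c * q / a / (c * b) = q / a by field_simp,
      show c * b * q / (b * c / a) = a * q by field_simp]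
    ring
  have hca : ∀ m : ℤ, c / a ≠ q ^ m := by simpa using inv_ne_zpow hac
  have hr := qPoch_div_qPoch (y := c / a) (z := q / (a / b)) hq0 (div_ne_zero hc0 ha0)
    (div_ne_zero hq0 (div_ne_zero ha0 hb0)) hca (q_div_ne_zpow hq0 hab) (k - n)
  rw [neg_sub, show q / (q / (a / b)) = a / b by field_simp, show q / (c / a) = a * q / c by field_simp,
    show c / a / (q / (a / b)) = c / b * q⁻¹ by field_simp, mul_zpow, inv_zpow', neg_sub] at hr
  rw [schlosserA, schlosserB, hP, show b * c / a / b = c / a by field_simp,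
    show b * c / a * q / c = q / (a / b) by field_simp,
    show c * b * q ^ (2 * n) / (b * c / a) = a * q ^ (2 * n) by field_simp,
    show c * b / (b * c / a) = a by field_simp, mul_div_mul_comm, hr, mul_div_mul_comm]
  ring

/-- The companion of `schlosserA_dual`, which turns `A` into `B`. -/
lemma schlosserB_dual {q a b c : ℂ} (hq0 : q ≠ 0) (ha0 : a ≠ 0) (hb0 : b ≠ 0) (hc0 : c ≠ 0)
    (hab : ∀ m : ℤ, a / b ≠ q ^ m) (hac : ∀ m : ℤ, a / c ≠ q ^ m) (n k : ℤ) :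
    schlosserPrefactor q a b c * schlosserB q (b * c / a) c b n k =
      (c / b) ^ (k - n) * schlosserA q a b c n k := by
  have hba : ∀ m : ℤ, b / a ≠ q ^ m := by simpa using inv_ne_zpow hab
  have hr := qPoch_div_qPoch (y := b / a) (z := q / (a / c)) hq0 (div_ne_zero hb0 ha0)
    (div_ne_zero hq0 (div_ne_zero ha0 hc0)) hba (q_div_ne_zpow hq0 hac) (n - k)
  rw [neg_sub, show q / (q / (a / c)) = a / c by field_simp, show q / (b / a) = a * q / b by field_simp,
    show b / a / (q / (a / c)) = (c / b)⁻¹ * q⁻¹ by field_simp, mul_zpow, inv_zpow', inv_zpow',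
    neg_sub] at hr
  have hqq : q ^ (k - n) * q ^ (n - k) = 1 := by
    rw [← zpow_add₀ hq0, sub_add_sub_cancel, sub_self, zpow_zero]
  rw [schlosserA, schlosserB, show b * c / a / c = b / a by field_simp,
    show b * c / a * q / b = q / (a / c) by field_simp,
    show b * c * q ^ (2 * n) / a = b * c / a * q ^ (2 * n) by ring, mul_div_mul_comm, hr,
    mul_div_mul_comm (qPoch b q (n + k))]
  linear_combination (schlosserPrefactor q a b c * ((1 - b * c / a * q ^ (2 * n)) /
    (1 - b * c / a)) * (qPoch b q (n + k) / qPoch (c * q) q (n + k)) * ((c / b) ^ (k - n) *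
    (qPoch (a / c) q (k - n) / qPoch (a * q / b) q (k - n)))) * hqq

theorem mainTheorem8 (q a b c : ℂ) (hq0 : q ≠ 0) (hq1 : ‖q‖ < 1)
    (ha0 : a ≠ 0) (hb0 : b ≠ 0) (hc0 : c ≠ 0)
    (ha : ∀ m : ℤ, a ≠ q ^ m) (hb : ∀ m : ℤ, b ≠ q ^ m) (hc : ∀ m : ℤ, c ≠ q ^ m)
    (hab : ∀ m : ℤ, a / b ≠ q ^ m) (hac : ∀ m : ℤ, a / c ≠ q ^ m)
    (hbca : ∀ m : ℤ, b * c / a ≠ q ^ m)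
    (hbc : ∀ m : ℤ, m ≠ 0 → b / c ≠ q ^ m) :
    AreInverseBilateral (schlosserA q a b c) (schlosserB q a b c) := by
  refine ⟨hasSum_schlosserA_mul_schlosserB hq0 hq1 ha0 hb0 hc0 ha hb hc hab hac hbca hbc,
    fun n l => ?_⟩
  have hcb := div_ne_zero hc0 hb0
  have hdual := hasSum_schlosserA_mul_schlosserB hq0 hq1
    (div_ne_zero (mul_ne_zero hb0 hc0) ha0) hc0 hb0 hbca hc hb
    (fun m h => inv_ne_zpow hab m (by rw [← h]; field_simp))
    (fun m h => inv_ne_zpow hac m (by rw [← h]; field_simp))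
    (fun m h => ha m (by rw [← h]; field_simp))
    (fun m hm h => hbc (-m) (by omega) (by rw [zpow_neg, ← h, inv_div])) n l
  have hconj : ∀ k, schlosserB q a b c n k * schlosserA q a b c k l =
      (c / b) ^ (n - l) *
        (schlosserA q (b * c / a) c b n k * schlosserB q (b * c / a) c b k l) := fun k => by
    have h2 := schlosserB_dual hq0 ha0 hb0 hc0 hab hac k l
    have h3 : (c / b) ^ (n - l) * ((c / b) ^ (k - n) * (c / b) ^ (l - k)) = 1 := by
      rw [← zpow_add₀ hcb, ← zpow_add₀ hcb, show n - l + (k - n + (l - k)) = 0 by ring, zpow_zero]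
    rw [schlosserA_dual hq0 ha0 hb0 hc0 hab hac n k]
    linear_combination (-(schlosserB q a b c n k * schlosserA q a b c k l)) * h3 -
      (c / b) ^ (n - l) * (c / b) ^ (k - n) * schlosserB q a b c n k * h2
  simp_rw [hconj]
  have hone : (1 : Matrix ℤ ℤ ℂ) n l = (c / b) ^ (n - l) * (1 : Matrix ℤ ℤ ℂ) n l := by
    by_cases hnl : n = l
    · rw [hnl, sub_self, zpow_zero, one_mul]
    · rw [Matrix.one_apply_ne hnl, mul_zero]
  rw [hone]
  exact hdual.mul_left _
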